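/- Let $b,c$ be integers and $d=b^2-4c$. For $n\ge 0$ let $T_n(b,c)$ be the coefficient of $x^n$ in $(x^2+bx+c)^n$, and let $M_n(b,c)=\sum_{k=0}^{\lfloor n/2\rfloor}\binom{n}{2k}C_k\,b^{n-2k}c^k$, where $C_k=\frac1{k+1}\binom{2k}{k}$ is the $k$-th Catalan number and $0^0=1$. For $1\le k\le n$ let $w(n,k)=\frac1k\binom{n-1}{k-1}\binom{n+k}{k-1}$. For integers $A,B$ let $u_0(A,B)=0$, $u_1(A,B)=1$ and $u_{n+1}(A,B)=A\,u_n(A,B)-B\,u_{n-1}(A,B)$ for $n\ge1$. For an odd prime $p$ let $\left(\frac{\cdot}{p}\right)$ be the Legendre symbol, and let $q_p(z)=(z^{p-1}-1)/p$ for integers $z$ not divisible by $p$. For rational numbers $x,y$ and $r\ge1$, $x\equiv y\pmod{p^r}$ means that $x-y=p^r z$ for some rational number $z$ whose denominator is not divisible by $p$. (i) For every integer $n\ge1$, $$\frac1n\sum_{k=0}^{n-1}T_k(b,c)M_k(b,c)d^{\,n-1-k}=\sum_{k=1}^{n}w(n,k)\,C_{k-1}\,c^{k-1}d^{\,n-k}\in\mathbb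 Z.$$ Moreover, for every odd prime $p$ not dividing $cd$, $$\sum_{k=0}^{p-1}\frac{T_k(b,c)M_k(b,c)}{d^k}\equiv\frac{pb^2}{2c}\left(\left(\frac dp\right)-1\right)\pmod{p^2},$$ and furthermore $$\begin{aligned}\sum_{k=0}^{p-1}\frac{T_k(b,c)M_k(b,c)}{d^k}\equiv{}&\frac{pb^2}{2c}\left(\left(\frac dp\right)-1\right)+\frac{p^2}{2c}\left(b^2\left(q_p(d)-q_p(c)+\left(\frac dp\right)\right)-d\right)\\&-\frac{pb^2}{4c^{\,2-\left(\frac dp\right)}}\left(2c+d\left(\frac dp\right)\right)u_{p-\left(\frac dp\right)}(b^2-2c,\,c^2)\pmod{p^3}.\end{aligned}$$ (ii) For every odd prime $p$ not dividing $d$, $$\sum_{k=0}^{p-1}\frac{k\,T_k(b,c)M_k(b,c)}{d^k}\equiv2\left(\frac{cd}p\right)\pmod p.$$ -/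

import Mathlib

namespace TrinomialMotzkin

/-- The generalized central trinomial coefficient `T_n(b,c)`: the coefficient of `x^n` in
`(x^2 + b x + c)^n`. -/
noncomputable def T (n : ℕ) (b c : ℤ) : ℤ :=
  ((Polynomial.X ^ 2 + Polynomial.C b * Polynomial.X + Polynomial.C c) ^ n : Polynomial ℤ).coeff n

/-- The generalized Motzkin number `M_n(b,c) = ∑_{k ≤ n/2} binom(n,2k) C_k b^(n-2k) c^k`,
with `C_k` the Catalan number. -/
def M (n : ℕ) (b c : ℤ) : ℤ :=
  ∑ k ∈ Finset.range (n / 2 + 1), (n.choose (2 * k) : ℤ) * (catalan k : ℤ) * b ^ (n - 2 * k) * c ^ k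

/-- `w(n,k) = (1/k) binom(n-1,k-1) binom(n+k,k-1)`, a rational number, for `n, k ≥ 1`. -/
def w (n k : ℕ) : ℚ :=
  (1 / (k : ℚ)) * ((n - 1).choose (k - 1) : ℚ) * ((n + k).choose (k - 1) : ℚ)

/-- The Lucas sequence: `u_0 = 0`, `u_1 = 1`, `u_{n+2} = A u_{n+1} - B u_n`. -/
def u (A B : ℤ) : ℕ → ℤ
  | 0 => 0
  | 1 => 1
  | n + 2 => A * u A B (n + 1) - B * u A B n

/-- The Fermat quotient `q_p(z) = (z^(p-1) - 1) / p`. -/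
def fermatQuotient (p : ℕ) (z : ℤ) : ℚ :=
  ((z : ℚ) ^ (p - 1) - 1) / (p : ℚ)

/-- Congruence of rational numbers modulo `m`: the difference `x - y` is `m` times a rational
number whose reduced denominator is prime to `m`. For `m = p ^ r` with `p` prime and `r ≥ 1` this
says `x - y ∈ p ^ r ℤ_(p)`, i.e. `x ≡ y (mod p ^ r)` in the ring of `p`-adic integers when
`x` and `y` are `p`-integral. -/
def RatModEq (m : ℕ) (x y : ℚ) : Prop :=
  ∃ z : ℚ, z.den.Coprime m ∧ x - y = (m : ℚ) * z

end TrinomialMotzkin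

namespace TrinomialMotzkin

open Polynomial Finset

/-! Let `S n` be the coefficient of x^(n+1) in (x²+bx+c)^n. Then S_{n+1} = (n+1) M_n, and the pair
(T, S) obeys a first-order linear recurrence. So T², bTS and S², which are even in b, become
polynomials in c and d = b²-4c with explicit hypergeometric coefficients (`products_eq_homSum`).
Since (n+2) M_n = 2T_n + bS_n, this gives T_n M_n = P_{n+1} - d P_n with P_n = Σ n w(n,k+1) C_k c^k
d^(n-1-k). The sum telescopes, and w is an integer.

For (ii), Abel summation reduces the sum to -Σ_{n<p} P_n/d^(n-1) modulo p. Each coefficient of a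
power of c/d is then a sum over n of a product of binomials times a Catalan number. All of them
vanish mod p except at k = (p-1)/2, where Euler's criterion produces the Legendre symbol.

For the p² and p³ congruences, divide the sum by p and use w(p,k+1) ≡ (-1)^k (1 - p + p/(k+1)) mod
p² for k+1 < p. With α+β = 1 and αβ = -c/d, the resulting truncated sums of C_k (αβ)^k and C_k
(αβ)^k/(k+1) are expressed through α^p and β^p (`sum_w_catalan_cong`). The numbers dα² and dβ² are
the characteristic roots of the Lucas sequence, so u_{p-ε} is expressed through the same powers. The
norm relation d^p (αβ)^p = -c^p brings in the Fermat quotients, and `target_identity` compares the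
two sides. As α-β = b/√d may be irrational, the computation takes place in the p-integral complex
numbers `pInt p`. -/

/-- The quadratic polynomial `x^2 + b x + c`. -/
noncomputable def quad (b c : ℤ) : ℤ[X] := X ^ 2 + C b * X + C c

/-! ### Recurrences linking T, S and M -/

/-- The coefficient of `x^(n+1)` in `(x^2 + b x + c)^n`. -/
noncomputable def S (n : ℕ) (b c : ℤ) : ℤ := ((quad b c) ^ n).coeff (n + 1)

theorem T_eq_coeff (n : ℕ) (b c : ℤ) : T n b c = ((quad b c) ^ n).coeff n := rfl

theorem coeff_mul_quad (f : ℤ[X]) (b c : ℤ) (j : ℕ) :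
    (f * quad b c).coeff (j + 2) = f.coeff j + b * f.coeff (j + 1) + c * f.coeff (j + 2) := by
  have : f * quad b c = f * X ^ 2 + C b * (f * X) + C c * f := by unfold quad; ring
  rw [this]
  simp only [coeff_add, coeff_C_mul, coeff_mul_X_pow, coeff_mul_X]


/-- Compare coefficients of x^(j+1) in the derivative of (x²+bx+c)^(n+1). -/
theorem coeff_quad_pow_succ_derivative (n j : ℕ) (b c : ℤ) :
    ((quad b c) ^ (n + 1)).coeff (j + 2) * (j + 2) =
      (n + 1) * (2 * ((quad b c) ^ n).coeff j + b * ((quad b c) ^ n).coeff (j + 1)) := by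
  have h : derivative ((quad b c) ^ (n + 1)) =
      C ((n : ℤ) + 1) * (C 2 * ((quad b c) ^ n * X) + C b * (quad b c) ^ n) := by
    rw [derivative_pow_succ]
    have : derivative (quad b c) = C 2 * X + C b := by
      simp [quad]
    rw [this]
    ring
  have h2 := congrArg (fun f => f.coeff (j + 1)) h
  simp only [coeff_derivative, coeff_add, coeff_C_mul, coeff_mul_X] at h2
  push_cast at h2
  linarith

theorem T_zero (b c : ℤ) : T 0 b c = 1 := by simp [T]

theorem S_zero (b c : ℤ) : S 0 b c = 0 := by simp [S, coeff_one]

/-- The product rule for coefficients and the derivative rule both express T_{n+1}. Eliminating the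
coefficient of x^(n-1) between them leaves only T_n and S_n. -/
theorem T_succ (n : ℕ) (b c : ℤ) : T (n + 1) b c = b * T n b c + 2 * c * S n b c := by
  rcases n with _ | n
  · simp [T, S, quad, coeff_one, coeff_C, -eq_intCast]
  · have h1 := coeff_mul_quad ((quad b c) ^ (n + 1)) b c n
    have h2 := coeff_quad_pow_succ_derivative (n + 1) n b c
    rw [← pow_succ] at h1
    simp only [T_eq_coeff, S]
    push_cast at h2
    have h3 : ((n : ℤ) + 2) ≠ 0 := by positivity
    have h4 : ((quad b c) ^ (n + 1 + 1)).coeff (n + 2) =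
      2 * ((quad b c) ^ (n + 1)).coeff n + b * ((quad b c) ^ (n + 1)).coeff (n + 1) := by
      apply mul_left_cancel₀ h3
      linarith
    change ((quad b c) ^ (n + 1 + 1)).coeff (n + 2) = _ + 2 * c * ((quad b c) ^ (n + 1)).coeff (n + 2)
    linarith

theorem S_succ (n : ℕ) (b c : ℤ) :
    (n + 2) * S (n + 1) b c = (n + 1) * (2 * T n b c + b * S n b c) := by
  have h2 := coeff_quad_pow_succ_derivative n n b c
  simp only [T_eq_coeff, S]
  rw [← h2]; ring

theorem coeff_X_sq_add_C_pow (m k : ℕ) (c : ℤ) :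
    ((X ^ 2 + C c : ℤ[X]) ^ m).coeff k =
      ∑ i ∈ range (m + 1), if 2 * i = k then c ^ (m - i) * (m.choose i : ℤ) else 0 := by
  rw [add_pow, finsetSum_coeff]
  refine sum_congr rfl fun i _ => ?_
  have : ((X ^ 2) ^ i * C c ^ (m - i) * (m.choose i : ℤ[X])) =
      C (c ^ (m - i) * (m.choose i : ℤ)) * X ^ (2 * i) := by
    rw [← pow_mul]; simp; ring
  rw [this, coeff_C_mul_X_pow]
  simp only [eq_comm]

theorem S_succ_eq_sum (n : ℕ) (b c : ℤ) :
    S (n + 1) b c = ∑ m ∈ range (n + 2),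
      (((X ^ 2 + C c : ℤ[X]) ^ m).coeff (m + 1) * b ^ (n + 1 - m) * ((n + 1).choose m : ℤ)) := by
  have : quad b c = (X ^ 2 + C c) + C b * X := by unfold quad; ring
  rw [S, this, add_pow, finsetSum_coeff]
  refine sum_congr rfl fun m hm => ?_
  have hm : m ≤ n + 1 := by simpa [Nat.lt_succ_iff] using hm
  have : (X ^ 2 + C c : ℤ[X]) ^ m * (C b * X) ^ (n + 1 - m) * ((n + 1).choose m : ℤ[X]) =
      C (b ^ (n + 1 - m) * ((n + 1).choose m : ℤ)) * ((X ^ 2 + C c) ^ m * X ^ (n + 1 - m)) := by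
    rw [mul_pow]; simp; ring
  rw [this, coeff_C_mul]
  have h : n + 1 + 1 = (m + 1) + (n + 1 - m) := by omega
  rw [h, coeff_mul_X_pow]
  ring

theorem coeff_X_sq_add_C_pow_odd (k : ℕ) (c : ℤ) :
    ((X ^ 2 + C c : ℤ[X]) ^ (2 * k + 1)).coeff (2 * k + 2) = c ^ k * ((2 * k + 1).choose (k + 1) : ℤ) := by
  rw [coeff_X_sq_add_C_pow, sum_eq_single (k + 1)]
  · rw [if_pos (by ring)]; congr 2; omega
  · intro i _ hi; rw [if_neg]; omega
  · intro h; simp at h; omega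

theorem coeff_X_sq_add_C_pow_even (k : ℕ) (c : ℤ) :
    ((X ^ 2 + C c : ℤ[X]) ^ (2 * k)).coeff (2 * k + 1) = 0 := by
  rw [coeff_X_sq_add_C_pow]
  refine sum_eq_zero fun i _ => if_neg ?_
  omega

theorem choose_mul_choose_eq_succ_mul_catalan (n k : ℕ) :
    (n + 1).choose (2 * k + 1) * (2 * k + 1).choose (k + 1) = (n + 1) * (n.choose (2 * k) * catalan k) := by
  have h1 := Nat.add_one_mul_choose_eq n (2 * k)
  have h2 := Nat.add_one_mul_choose_eq (2 * k) k
  have h3 := succ_mul_catalan_eq_centralBinom k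
  rw [Nat.centralBinom] at h3
  have : (2 * k + 1) * (k + 1) ≠ 0 := by positivity
  apply Nat.eq_of_mul_eq_mul_right (Nat.pos_of_ne_zero this)
  calc _ = ((n + 1).choose (2 * k + 1) * (2 * k + 1)) * ((2 * k + 1).choose (k + 1) * (k + 1)) := by ring
    _ = _ := by rw [← h1, ← h2, ← h3]; ring

/-- Expand the power of (x²+c) + bx. A power of x²+c has no odd coefficients, so only m = 2k+1
contributes, and absorption turns its binomials into a Catalan number. -/
theorem S_succ_eq_mul_M (n : ℕ) (b c : ℤ) : S (n + 1) b c = (n + 1) * M n b c := by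
  rw [S_succ_eq_sum, M, mul_sum]
  symm
  apply sum_of_injOn (fun k => 2 * k + 1)
  · intro a _ b _ h; simpa using h
  · intro k hk; simp at hk ⊢; omega
  · intro m hm hm'
    rcases Nat.even_or_odd' m with ⟨k, rfl | rfl⟩
    · rw [coeff_X_sq_add_C_pow_even]; simp
    · exfalso; apply hm'; simp at hm ⊢; omega
  · intro k hk
    rw [coeff_X_sq_add_C_pow_odd]
    have := congrArg (Nat.cast : ℕ → ℤ) (choose_mul_choose_eq_succ_mul_catalan n k)
    push_cast at this
    have h : n + 1 - (2 * k + 1) = n - 2 * k := by omega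
    rw [h]
    linear_combination (-c ^ k * b ^ (n - 2 * k)) * this

theorem M_recurrence (n : ℕ) (b c : ℤ) : (n + 2) * M n b c = 2 * T n b c + b * S n b c := by
  have h := S_succ n b c
  rw [S_succ_eq_mul_M] at h
  have h3 : ((n : ℤ) + 1) ≠ 0 := by positivity
  apply mul_left_cancel₀ h3
  linarith

/-! ### Products of T and S as homogeneous polynomials in c and d -/

/-- The homogeneous sum `∑_{k < N} f(k) c^k d^(N-1-k)`. -/
def homSum (c d : ℚ) (N : ℕ) (f : ℕ → ℚ) : ℚ := ∑ k ∈ range N, f k * c ^ k * d ^ (N - 1 - k)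

/-- The sequence `0, f 0, f 1, …`. -/
def shift (f : ℕ → ℚ) : ℕ → ℚ
  | 0 => 0
  | k + 1 => f k

theorem homSum_add (c d : ℚ) (N : ℕ) (f g : ℕ → ℚ) :
    homSum c d N f + homSum c d N g = homSum c d N (fun k => f k + g k) := by
  simp only [homSum, ← sum_add_distrib]
  exact sum_congr rfl fun _ _ => by ring

theorem smul_homSum (c d : ℚ) (N : ℕ) (f : ℕ → ℚ) (a : ℚ) :
    a * homSum c d N f = homSum c d N (fun k => a * f k) := by
  simp only [homSum, mul_sum]
  exact sum_congr rfl fun _ _ => by ring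

/-- Multiplying by d leaves the index alone but raises the degree, so the longer sum gains an index
N, whose coefficient must vanish. -/
theorem right_mul_homSum (c d : ℚ) (N : ℕ) (f : ℕ → ℚ) (hf : f N = 0) :
    d * homSum c d N f = homSum c d (N + 1) f := by
  rw [homSum, homSum, sum_range_succ, hf, mul_sum]
  simp only [zero_mul, add_zero]
  refine sum_congr rfl fun k hk => ?_
  have hk := mem_range.1 hk
  have : N + 1 - 1 - k = (N - 1 - k) + 1 := by omega
  rw [this]; ring

theorem left_mul_homSum (c d : ℚ) (N : ℕ) (f : ℕ → ℚ) :
    c * homSum c d N f = homSum c d (N + 1) (shift f) := by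
  rw [homSum, homSum, sum_range_succ', mul_sum]
  simp only [shift, zero_mul, add_zero]
  refine sum_congr rfl fun k hk => ?_
  have : N + 1 - 1 - (k + 1) = N - 1 - k := by omega
  rw [this]; ring

/-- The coefficients of `T_n^2`. -/
def sqCoeff (n k : ℕ) : ℚ := ((n + k).choose (2 * k) : ℚ) * ((2 * k).choose k : ℚ) ^ 2

/-- The coefficients of `b T_n S_n`. -/
def mixCoeff (n k : ℕ) : ℚ :=
  sqCoeff n k * ((2 * k + 1) * n * (n + 1) + k * (k + 1)) / ((n + 1) * (k + 1) ^ 2)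

/-- The coefficients of `S_n^2`. -/
def sqCoeff' (n k : ℕ) : ℚ :=
  sqCoeff n k * ((n - k) * n * (n + k + 1) * (2 * (2 * k + 1))) / ((n + 1) * (k + 1) ^ 2 * (k + 2))

theorem sqCoeff_eq_zero {n k : ℕ} (h : n < k) : sqCoeff n k = 0 := by
  simp [sqCoeff, Nat.choose_eq_zero_of_lt (show n + k < 2 * k by omega)]

theorem sqCoeff_zero (n : ℕ) : sqCoeff n 0 = 1 := by simp [sqCoeff]

theorem choose_two_mul_step (n k : ℕ) :
    ((n + (k + 1)).choose (2 * (k + 1)) : ℚ) * (2 * (k + 1) * (2 * k + 1)) =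
      ((n + k).choose (2 * k) : ℚ) * ((n + k + 1) * (n - k)) := by
  have h1 : ((n + k + 1).choose (2 * k + 1 + 1) : ℚ) * (2 * k + 1 + 1) =
      (n + k + 1) * (n + k).choose (2 * k + 1) := by
    exact_mod_cast (Nat.add_one_mul_choose_eq (n + k) (2 * k + 1)).symm
  have h2 : ((n + k).choose (2 * k + 1) : ℚ) * (2 * k + 1) = (n + k).choose (2 * k) * (n - k) := by
    rcases le_or_gt k n with h | h
    · have := Nat.choose_succ_right_eq (n + k) (2 * k)
      have h3 : n + k - 2 * k = n - k := by omega
      rw [h3] at this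
      have := congrArg (Nat.cast : ℕ → ℚ) this
      push_cast [Nat.cast_sub h] at this
      exact this
    · rw [Nat.choose_eq_zero_of_lt (show n + k < 2 * k by omega),
        Nat.choose_eq_zero_of_lt (show n + k < 2 * k + 1 by omega)]
      simp
  have h3 : n + (k + 1) = n + k + 1 := by ring
  have h4 : 2 * (k + 1) = 2 * k + 1 + 1 := by ring
  rw [h3, h4]
  linear_combination (2 * k + 1 : ℚ) * h1 + (n + k + 1 : ℚ) * h2

theorem centralBinom_step (k : ℕ) :
    ((2 * (k + 1)).choose (k + 1) : ℚ) * (k + 1) = 2 * (2 * k + 1) * ((2 * k).choose k : ℚ) := by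
  have := Nat.succ_mul_centralBinom_succ k
  simp only [Nat.centralBinom] at this
  have := congrArg (Nat.cast : ℕ → ℚ) this
  push_cast at this
  linarith

theorem sqCoeff_succ_right (n k : ℕ) :
    sqCoeff n (k + 1) = 2 * (2 * k + 1) * (n + k + 1) * (n - k) / (k + 1) ^ 3 * sqCoeff n k := by
  have h1 := choose_two_mul_step n k
  have h2 := centralBinom_step k
  have hk : (k : ℚ) + 1 ≠ 0 := by positivity
  have hk' : (2 * k : ℚ) + 1 ≠ 0 := by positivity
  rw [← eq_div_iff (by positivity)] at h1 h2
  rw [sqCoeff, sqCoeff, h1, h2]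
  field_simp

theorem sqCoeff_succ_left (n k : ℕ) :
    (n + 1 - k) * sqCoeff (n + 1) k = (n + 1 + k) * sqCoeff n k := by
  rcases le_or_gt k (n + 1) with h | h
  · have h0 := Nat.choose_mul_succ_eq (n + k) (2 * k)
    have h1 : n + k + 1 - 2 * k = n + 1 - k := by omega
    rw [h1] at h0
    have h0 := congrArg (Nat.cast : ℕ → ℚ) h0
    push_cast [Nat.cast_sub h] at h0
    have h2 : n + 1 + k = n + k + 1 := by ring
    rw [sqCoeff, sqCoeff, h2]
    linear_combination (-((2 * k).choose k : ℚ) ^ 2) * h0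
  · rw [sqCoeff_eq_zero h, sqCoeff_eq_zero (by omega)]; simp

/-- The factor n+1-k supplied by the step in k is exactly the one needed by the step in n, so no
division by n+1-k occurs and k > n is covered. -/
theorem sqCoeff_succ_succ (n k : ℕ) :
    sqCoeff (n + 1) (k + 1) =
      2 * (2 * k + 1) * (n + k + 2) * (n + 1 + k) / (k + 1) ^ 3 * sqCoeff n k := by
  rw [sqCoeff_succ_right]
  push_cast
  have := sqCoeff_succ_left n k
  linear_combination 2 * (2 * k + 1) * (n + k + 2) / (k + 1) ^ 3 * this

/-- This is the coefficient form of (bT+2cS)² = (d+4c)T² + 4c·bTS + 4c²S², each factor c being a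
`shift`. The two recurrences below do the same for bTS and S². All terms reduce to rational
multiples of a single `sqCoeff` value. -/
theorem sqCoeff_recurrence (n k : ℕ) : sqCoeff (n + 1) k =
    sqCoeff n k + 4 * shift (sqCoeff n) k + 4 * shift (mixCoeff n) k
      + 4 * shift (shift (sqCoeff' n)) k := by
  rcases k with _ | _ | k
  · simp [shift, sqCoeff_zero]
  · simp only [shift, sqCoeff_succ_succ, sqCoeff_succ_right n, mixCoeff, sqCoeff_zero]
    push_cast
    field_simp
    ring
  · simp only [shift, sqCoeff_succ_succ, sqCoeff_succ_right n, mixCoeff, sqCoeff']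
    push_cast
    field_simp
    ring

theorem mixCoeff_recurrence (n k : ℕ) : (n + 2) * mixCoeff (n + 1) k =
    (n + 1) * (2 * sqCoeff n k + 8 * shift (sqCoeff n) k + mixCoeff n k + 8 * shift (mixCoeff n) k
      + 2 * shift (sqCoeff' n) k + 8 * shift (shift (sqCoeff' n)) k) := by
  rcases k with _ | _ | k
  · simp only [shift, mixCoeff, sqCoeff_zero]
    push_cast
    field_simp
    ring
  · simp only [shift, mixCoeff, sqCoeff_succ_succ, sqCoeff_succ_right n, sqCoeff', sqCoeff_zero]
    push_cast
    field_simp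
    ring
  · simp only [shift, mixCoeff, sqCoeff_succ_succ, sqCoeff_succ_right n, sqCoeff']
    push_cast
    field_simp
    ring

theorem sqCoeff'_recurrence (n k : ℕ) : (n + 2) ^ 2 * sqCoeff' (n + 1) k =
    (n + 1) ^ 2 * (4 * sqCoeff n k + 4 * mixCoeff n k + sqCoeff' n k
      + 4 * shift (sqCoeff' n) k) := by
  rcases k with _ | k
  · simp only [shift, mixCoeff, sqCoeff_zero, sqCoeff']
    push_cast
    field_simp
    ring
  · simp only [shift, mixCoeff, sqCoeff_succ_succ, sqCoeff_succ_right n, sqCoeff']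
    push_cast
    field_simp
    ring

theorem mixCoeff_eq_zero {n k : ℕ} (h : n < k) : mixCoeff n k = 0 := by
  simp [mixCoeff, sqCoeff_eq_zero h]

theorem sqCoeff'_eq_zero {n k : ℕ} (h : n ≤ k) : sqCoeff' n k = 0 := by
  rcases h.lt_or_eq with h | rfl
  · simp [sqCoeff', sqCoeff_eq_zero h]
  · simp [sqCoeff']

/-- The three products are carried together because the recurrences mix them. The extra b in bTS
makes every product even in b, so b² = d+4c removes b altogether. -/
theorem products_eq_homSum (b c d : ℤ) (hd : d = b ^ 2 - 4 * c) (n : ℕ) :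
    (T n b c : ℚ) ^ 2 = homSum c d (n + 1) (sqCoeff n) ∧
    (b : ℚ) * T n b c * S n b c = homSum c d (n + 1) (mixCoeff n) ∧
    (S n b c : ℚ) ^ 2 = homSum c d n (sqCoeff' n) := by
  induction n with
  | zero => simp [T_zero, S_zero, homSum, sqCoeff_zero, mixCoeff]
  | succ n ih =>
    obtain ⟨hX, hY, hZ⟩ := ih
    have hT : (T (n + 1) b c : ℚ) = b * T n b c + 2 * c * S n b c := by
      exact_mod_cast T_succ n b c
    have hS : ((n : ℚ) + 2) * S (n + 1) b c = (n + 1) * (2 * T n b c + b * S n b c) := by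
      exact_mod_cast S_succ n b c
    have hb : (b : ℚ) ^ 2 = d + 4 * c := by rw [hd]; push_cast; ring
    have hn : (n : ℚ) + 2 ≠ 0 := by positivity
    -- These vanishing top coefficients are what `right_mul_homSum` requires for each multiplication
    -- by d.
    have X0 : sqCoeff n (n + 1) = 0 := sqCoeff_eq_zero (by omega)
    have Y0 : mixCoeff n (n + 1) = 0 := mixCoeff_eq_zero (by omega)
    have Z0 : sqCoeff' n n = 0 := sqCoeff'_eq_zero (by omega)
    have Z1 : sqCoeff' n (n + 1) = 0 := sqCoeff'_eq_zero (by omega)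
    have Z0' : shift (sqCoeff' n) (n + 1) = 0 := Z0
    have dX := right_mul_homSum c d _ _ X0
    have dY := right_mul_homSum c d _ _ Y0
    have dZ := right_mul_homSum c d _ _ Z0
    have cX := left_mul_homSum c d (n + 1) (sqCoeff n)
    have cY := left_mul_homSum c d (n + 1) (mixCoeff n)
    have cZ := left_mul_homSum c d n (sqCoeff' n)
    have ccZ := left_mul_homSum c d (n + 1) (shift (sqCoeff' n))
    have dcZ := right_mul_homSum c d _ _ Z0'
    refine ⟨?_, ?_, ?_⟩
    · have : (T (n + 1) b c : ℚ) ^ 2 = d * homSum c d (n + 1) (sqCoeff n)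
          + 4 * (c * homSum c d (n + 1) (sqCoeff n))
          + 4 * (c * homSum c d (n + 1) (mixCoeff n))
          + 4 * (c * (c * homSum c d n (sqCoeff' n))) := by
        rw [hT, ← hX, ← hY, ← hZ]
        linear_combination (T n b c : ℚ) ^ 2 * hb
      rw [this, dX, cX, cY, cZ, ccZ]
      simp only [smul_homSum, homSum_add]
      congr 1
      funext k
      rw [sqCoeff_recurrence]
    · apply mul_left_cancel₀ hn
      have : ((n : ℚ) + 2) * ((b : ℚ) * T (n + 1) b c * S (n + 1) b c) = (n + 1) * (
          2 * (d * homSum c d (n + 1) (sqCoeff n))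
          + 8 * (c * homSum c d (n + 1) (sqCoeff n))
          + d * homSum c d (n + 1) (mixCoeff n)
          + 8 * (c * homSum c d (n + 1) (mixCoeff n))
          + 2 * (d * (c * homSum c d n (sqCoeff' n)))
          + 8 * (c * (c * homSum c d n (sqCoeff' n)))) := by
        rw [← hX, ← hY, ← hZ]
        linear_combination b * T (n + 1) b c * hS +
           (n + 1 : ℚ) * b * (2 * T n b c + b * S n b c) * hT
           + (n + 1 : ℚ) * (2 * (T n b c : ℚ) ^ 2 + b * T n b c * S n b c + 2 * c * (S n b c : ℚ) ^ 2)
            * hb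
      rw [this, dX, cX, cY, dY, cZ, ccZ, dcZ]
      simp only [smul_homSum, homSum_add]
      congr 1
      funext k
      rw [mixCoeff_recurrence]
    · have hn2 : ((n : ℚ) + 2) ^ 2 ≠ 0 := by positivity
      apply mul_left_cancel₀ hn2
      have : ((n : ℚ) + 2) ^ 2 * ((S (n + 1) b c : ℚ) ^ 2) = (n + 1) ^ 2 * (
          4 * (homSum c d (n + 1) (sqCoeff n))
          + 4 * (homSum c d (n + 1) (mixCoeff n))
          + (d * homSum c d n (sqCoeff' n))
          + 4 * (c * homSum c d n (sqCoeff' n))) := by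
        rw [← mul_pow, hS, ← hX, ← hY, ← hZ]
        linear_combination (n + 1 : ℚ) ^ 2 * (S n b c : ℚ) ^ 2 * hb
      rw [this, dZ, cZ]
      simp only [smul_homSum, homSum_add]
      congr 1
      funext k
      rw [sqCoeff'_recurrence]

/-! ### Telescoping and integrality -/

/-- The rational number `n w(n,k+1) C_k`, in binomial form. -/
def wCoeff (n k : ℕ) : ℚ := (n.choose (k + 1) : ℚ) * ((n + k + 1).choose k : ℚ) * (catalan k : ℚ)

theorem wCoeff_eq_zero {n k : ℕ} (h : n ≤ k) : wCoeff n k = 0 := by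
  simp [wCoeff, Nat.choose_eq_zero_of_lt (show n < k + 1 by omega)]

theorem wCoeff_eq (n k : ℕ) : wCoeff n k = sqCoeff n k * (n - k) * (n + k + 1) /
    ((n + 1) * (k + 1) ^ 2) := by
  rcases le_or_gt k n with h | h
  · have h1 : (catalan k : ℚ) = ((2 * k).choose k : ℚ) / (k + 1) := by
      rw [eq_div_iff (by positivity), mul_comm]
      exact_mod_cast succ_mul_catalan_eq_centralBinom k
    have h2 : (n.choose (k + 1) : ℚ) * (k + 1) = n.choose k * (n - k) := by
      have := congrArg (Nat.cast : ℕ → ℚ) (Nat.choose_succ_right_eq n k)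
      push_cast [Nat.cast_sub h] at this
      exact this
    have h3 : (n.choose k : ℚ) * ((n + k).choose k) =
        ((n + k).choose (2 * k) : ℚ) * ((2 * k).choose k) := by
      have := Nat.choose_mul (n := n + k) (show k ≤ 2 * k by omega)
      have e1 : n + k - k = n := by omega
      have e2 : 2 * k - k = k := by omega
      rw [e1, e2] at this
      rw [mul_comm]
      exact_mod_cast this.symm
    have h4 : ((n + k + 1).choose k : ℚ) * (n + 1) = (n + k).choose k * (n + k + 1) := by
      have := Nat.choose_mul_succ_eq (n + k) k
      have e1 : n + k + 1 - k = n + 1 := by omega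
      rw [e1] at this
      exact_mod_cast this.symm
    rw [← eq_div_iff (by positivity)] at h2 h4
    rw [wCoeff, sqCoeff, h1, h2, h4]
    field_simp
    linear_combination ((2 * k).choose k : ℚ) * (n - k) * h3
  · rw [wCoeff_eq_zero h.le, sqCoeff_eq_zero h]; simp

/-- The right side is the coefficient of (n+2) T_n M_n. Hence T_n M_n is a difference of consecutive
closed forms, which is why the weighted sum telescopes. -/
theorem wCoeff_recurrence (n k : ℕ) :
    (n + 2) * (wCoeff (n + 1) k - wCoeff n k) = 2 * sqCoeff n k + mixCoeff n k := by
  rw [wCoeff_eq, wCoeff_eq, mixCoeff]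
  have := sqCoeff_succ_left n k
  have h : sqCoeff (n + 1) k * ((n + 1 : ℕ) - k) = (n + 1 + k) * sqCoeff n k := by
    rw [← this]; push_cast; ring
  rw [h]
  push_cast
  field_simp
  ring

theorem T_mul_M_eq_homSum (b c d : ℤ) (hd : d = b ^ 2 - 4 * c) (n : ℕ) :
    (T n b c : ℚ) * M n b c = homSum c d (n + 1) (wCoeff (n + 1)) - d * homSum c d n (wCoeff n) := by
  obtain ⟨hX, hY, -⟩ := products_eq_homSum b c d hd n
  have hM : ((n : ℚ) + 2) * M n b c = 2 * T n b c + b * S n b c := by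
    exact_mod_cast M_recurrence n b c
  have hn : (n : ℚ) + 2 ≠ 0 := by positivity
  apply mul_left_cancel₀ hn
  rw [right_mul_homSum _ _ _ _ (wCoeff_eq_zero le_rfl)]
  have : ((n : ℚ) + 2) * ((T n b c : ℚ) * M n b c) = 2 * homSum c d (n + 1) (sqCoeff n) +
      homSum c d (n + 1) (mixCoeff n) := by
    rw [← hX, ← hY]; linear_combination T n b c * hM
  rw [this, mul_sub]
  simp only [smul_homSum, homSum_add]
  rw [eq_sub_iff_add_eq, homSum_add]
  congr 1
  funext k
  linear_combination -wCoeff_recurrence n k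

theorem sum_T_mul_M (b c d : ℤ) (hd : d = b ^ 2 - 4 * c) (n : ℕ) :
    ∑ k ∈ range n, (T k b c : ℚ) * M k b c * (d : ℚ) ^ (n - 1 - k) = homSum c d n (wCoeff n) := by
  induction n with
  | zero => simp [homSum]
  | succ n ih =>
    have : ∑ k ∈ range n, (T k b c : ℚ) * M k b c * (d : ℚ) ^ (n + 1 - 1 - k) =
        d * ∑ k ∈ range n, (T k b c : ℚ) * M k b c * (d : ℚ) ^ (n - 1 - k) := by
      rw [mul_sum]
      refine sum_congr rfl fun k hk => ?_
      have hk := mem_range.1 hk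
      have : n + 1 - 1 - k = (n - 1 - k) + 1 := by omega
      rw [this]; ring
    rw [sum_range_succ, this, ih, T_mul_M_eq_homSum b c d hd n]
    simp

theorem mul_w (n k : ℕ) :
    (n : ℚ) * w n (k + 1) * catalan k = wCoeff n k := by
  rcases n with _ | n
  · simp [wCoeff]
  · have h := congrArg (Nat.cast : ℕ → ℚ) (Nat.add_one_mul_choose_eq n k)
    push_cast at h
    rw [w, wCoeff]
    simp only [Nat.add_sub_cancel, ← add_assoc]
    push_cast
    field_simp
    linear_combination ((n + 1 + k + 1).choose k : ℚ) * catalan k * h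

/-- By absorption the two products equal (n+1) w and n w, so their difference is w. -/
theorem w_succ_eq_intCast (n k : ℕ) (hn : 0 < n) : w n (k + 1) =
    (((n - 1).choose k : ℤ) * ((n + k + 1).choose (k + 1) : ℤ) -
     (n.choose (k + 1) : ℤ) * ((n + k + 1).choose k : ℤ) : ℤ) := by
  obtain ⟨n, rfl⟩ := Nat.exists_eq_add_of_lt hn
  rw [zero_add]
  have h1 := congrArg (Nat.cast : ℕ → ℚ) (Nat.add_one_mul_choose_eq n k)
  have h2 := congrArg (Nat.cast : ℕ → ℚ) (Nat.choose_succ_right_eq (n + 1 + k + 1) k)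
  have e : n + 1 + k + 1 - k = n + 2 := by omega
  rw [e] at h2
  push_cast at h1 h2
  rw [w]
  simp only [Nat.add_sub_cancel, ← add_assoc]
  push_cast
  field_simp
  linear_combination (-((n).choose k : ℚ)) * h2 - ((n + 1 + k + 1).choose k : ℚ) * h1

theorem sum_w_eq (c d : ℤ) (n : ℕ) : (n : ℚ) * ∑ k ∈ Icc 1 n,
    w n k * (catalan (k - 1) : ℚ) * (c : ℚ) ^ (k - 1) * (d : ℚ) ^ (n - k) =
    homSum c d n (wCoeff n) := by
  rw [homSum, mul_sum]
  refine sum_nbij' (· - 1) (· + 1) ?_ ?_ ?_ ?_ ?_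
  · intro k hk; simp at hk ⊢; omega
  · intro k hk; simp at hk ⊢; omega
  · intro k hk; simp at hk ⊢; omega
  · intro k hk; simp
  · intro k hk
    obtain ⟨k, rfl⟩ := Nat.exists_eq_add_of_le' (mem_Icc.1 hk).1
    have e : n - (k + 1) = n - 1 - k := by omega
    rw [Nat.add_sub_cancel, e, ← mul_w]
    ring

theorem sum_w_mem_int (c d : ℤ) (n : ℕ) : ∃ z : ℤ, ∑ k ∈ Icc 1 n,
    w n k * (catalan (k - 1) : ℚ) * (c : ℚ) ^ (k - 1) * (d : ℚ) ^ (n - k) = (z : ℚ) := by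
  have (k : ℕ) (hk : k ∈ Icc 1 n) : ∃ z : ℤ, w n k * (catalan (k - 1) : ℚ) * (c : ℚ) ^ (k - 1) *
      (d : ℚ) ^ (n - k) = z := by
    obtain ⟨h1, h2⟩ := mem_Icc.1 hk
    obtain ⟨k, rfl⟩ := Nat.exists_eq_add_of_le' h1
    obtain ⟨a, ha⟩ : ∃ a : ℤ, w n (k + 1) = a := ⟨_, w_succ_eq_intCast n k (by omega)⟩
    rw [ha]
    exact ⟨a * (catalan (k + 1 - 1) : ℤ) * c ^ (k + 1 - 1) * d ^ (n - (k + 1)), by push_cast; rfl⟩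
  choose! f hf using this
  exact ⟨∑ k ∈ Icc 1 n, f k, by rw [sum_congr rfl hf]; push_cast; rfl⟩

theorem mean_T_mul_M (b c d : ℤ) (hd : d = b ^ 2 - 4 * c) (n : ℕ) (hn : 0 < n) :
    (1 / (n : ℚ)) * ∑ k ∈ range n, (T k b c : ℚ) * (M k b c : ℚ) * (d : ℚ) ^ (n - 1 - k) =
      ∑ k ∈ Icc 1 n, w n k * (catalan (k - 1) : ℚ) * (c : ℚ) ^ (k - 1) * (d : ℚ) ^ (n - k) := by
  rw [sum_T_mul_M b c d hd, ← sum_w_eq]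
  field_simp

/-- The sum `∑ T_k M_k / d^k` as a polynomial in `c / d`. -/
theorem sum_T_mul_M_div (b c d : ℤ) (hd : d = b ^ 2 - 4 * c) (hd0 : d ≠ 0) (n : ℕ) :
    ∑ k ∈ range n, (T k b c : ℚ) * M k b c / (d : ℚ) ^ k =
      ∑ k ∈ range n, wCoeff n k * ((c : ℚ) / d) ^ k := by
  have hd' : (d : ℚ) ≠ 0 := by exact_mod_cast hd0
  have key : ∀ k ∈ range n, ∀ a : ℚ, a / (d : ℚ) ^ k = a * (d : ℚ) ^ (n - 1 - k) / d ^ (n - 1) := by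
    intro k hk a
    have hk := mem_range.1 hk
    rw [div_eq_div_iff (by positivity) (by positivity), mul_assoc, ← pow_add]
    congr 2; omega
  rw [sum_congr rfl fun k hk => key k hk _, ← sum_div, sum_T_mul_M b c d hd, homSum, sum_div]
  refine sum_congr rfl fun k hk => ?_
  rw [← key k hk, div_pow]; ring

/-! ### Congruences in the p-integral complex numbers -/

/-- The complex numbers that are integral at `p`: those with a multiple by an integer prime to `p`
that is an algebraic integer. -/
def pInt (p : ℕ) : Subring ℂ where
  carrier := {z | ∃ m : ℕ, m.Coprime p ∧ IsIntegral ℤ ((m : ℂ) * z)}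
  mul_mem' := by
    rintro a b ⟨m, hm, ha⟩ ⟨n, hn, hb⟩
    refine ⟨m * n, hm.mul_left hn, ?_⟩
    have : ((m * n : ℕ) : ℂ) * (a * b) = (m * a) * (n * b) := by push_cast; ring
    rw [this]; exact ha.mul hb
  one_mem' := ⟨1, Nat.coprime_one_left p, by simpa using isIntegral_one⟩
  add_mem' := by
    rintro a b ⟨m, hm, ha⟩ ⟨n, hn, hb⟩
    refine ⟨m * n, hm.mul_left hn, ?_⟩
    have : ((m * n : ℕ) : ℂ) * (a + b) = (n : ℤ) * (m * a) + (m : ℤ) * (n * b) := by push_cast; ring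
    rw [this]
    exact (IsIntegral.mul isIntegral_algebraMap ha).add (IsIntegral.mul isIntegral_algebraMap hb)
  zero_mem' := ⟨1, Nat.coprime_one_left p, by simpa using isIntegral_zero⟩
  neg_mem' := by
    rintro a ⟨m, hm, ha⟩
    exact ⟨m, hm, by simpa using ha.neg⟩

theorem mem_pInt_of_isIntegral {p : ℕ} {z : ℂ} (hz : IsIntegral ℤ z) : z ∈ pInt p :=
  ⟨1, Nat.coprime_one_left p, by simpa using hz⟩

theorem inv_natCast_mem {p m : ℕ} (hm : m.Coprime p) (h0 : m ≠ 0) : (m : ℂ)⁻¹ ∈ pInt p :=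
  ⟨m, hm, by rw [mul_inv_cancel₀ (by exact_mod_cast h0)]; exact isIntegral_one⟩

theorem inv_intCast_mem {p : ℕ} [hp : Fact p.Prime] {m : ℤ} (hm : ¬ (p : ℤ) ∣ m) :
    (m : ℂ)⁻¹ ∈ pInt p := by
  have h0 : m.natAbs ≠ 0 := by rintro h; apply hm; simp [Int.natAbs_eq_zero.1 h]
  have hc : m.natAbs.Coprime p := by
    rw [Nat.coprime_comm, hp.out.coprime_iff_not_dvd, ← Int.natCast_dvd]; exact hm
  have := inv_natCast_mem hc h0
  rcases Int.natAbs_eq m with h | h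
  · rw [h, Int.cast_natCast]; exact this
  · rw [h, Int.cast_neg, Int.cast_natCast, inv_neg]; exact neg_mem this

theorem inv_natCast_mem_of_lt {p k : ℕ} [hp : Fact p.Prime] (h0 : 0 < k) (hk : k < p) :
    (k : ℂ)⁻¹ ∈ pInt p :=
  inv_natCast_mem (Nat.coprime_of_lt_prime h0.ne' hk hp.out).symm h0.ne'

/-- A rational algebraic integer is an integer, so the denominator divides the multiplier m, which
is prime to p. This brings complex congruences back to rational ones. -/
theorem den_coprime_of_mem {p : ℕ} {q : ℚ} (hq : (q : ℂ) ∈ pInt p) : q.den.Coprime p := by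
  obtain ⟨m, hm, hi⟩ := hq
  have h1 : IsIntegral ℤ ((m : ℚ) * q) := by
    have : algebraMap ℚ ℂ ((m : ℚ) * q) = (m : ℂ) * q := by simp
    rw [← this] at hi
    exact (isIntegral_algebraMap_iff (algebraMap ℚ ℂ).injective).1 hi
  obtain ⟨k, hk⟩ := IsIntegrallyClosed.isIntegral_iff.1 h1
  have hk : (k : ℚ) = m * q := by simpa using hk
  have hd : q.den ∣ m := by
    have h2 : (k : ℚ) * q.den = m * q.num := by
      rw [hk, mul_assoc, Rat.mul_den_eq_num]
    have h3 : k * q.den = m * q.num := by exact_mod_cast h2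
    have h4 : (q.den : ℤ) ∣ m * q.num := ⟨k, by rw [← h3]; ring⟩
    have h5 : IsCoprime (q.den : ℤ) q.num := by
      rw [Int.isCoprime_iff_nat_coprime]; simpa using q.reduced.symm
    exact_mod_cast h5.dvd_of_dvd_mul_right h4
  exact hm.coprime_dvd_left hd

/-- Congruence modulo `p^r` in the ring of complex numbers integral at `p`. -/
def Cong (p r : ℕ) (x y : ℂ) : Prop := ∃ z ∈ pInt p, x - y = (p : ℂ) ^ r * z

theorem Cong.ratModEq {p r : ℕ} [hp : Fact p.Prime] {x y : ℚ} (h : Cong p r x y) :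
    RatModEq (p ^ r) x y := by
  obtain ⟨z, hz, h⟩ := h
  have hp0 : (p : ℚ) ^ r ≠ 0 := pow_ne_zero _ (by exact_mod_cast hp.out.ne_zero)
  have hp0' : (p : ℂ) ^ r ≠ 0 := pow_ne_zero _ (by exact_mod_cast hp.out.ne_zero)
  refine ⟨(x - y) / p ^ r, Nat.Coprime.pow_right _ (den_coprime_of_mem (p := p) ?_), ?_⟩
  · have : (((x - y) / p ^ r : ℚ) : ℂ) = z := by
      push_cast; rw [h]; field_simp
    rwa [this]
  · push_cast; field_simp

namespace Cong

variable {p r : ℕ} {x y z w x' y' : ℂ}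

theorem refl (x : ℂ) : Cong p r x x := ⟨0, zero_mem _, by simp⟩

theorem of_eq (h : x = y) : Cong p r x y := h ▸ refl x

theorem symm (h : Cong p r x y) : Cong p r y x := by
  obtain ⟨a, ha, h⟩ := h
  exact ⟨-a, neg_mem ha, by linear_combination -h⟩

theorem trans (h : Cong p r x y) (h' : Cong p r y z) : Cong p r x z := by
  obtain ⟨a, ha, h⟩ := h
  obtain ⟨b, hb, h'⟩ := h'
  exact ⟨a + b, add_mem ha hb, by linear_combination h + h'⟩

theorem add (h : Cong p r x y) (h' : Cong p r x' y') : Cong p r (x + x') (y + y') := by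
  obtain ⟨a, ha, h⟩ := h
  obtain ⟨b, hb, h'⟩ := h'
  exact ⟨a + b, add_mem ha hb, by linear_combination h + h'⟩

theorem neg (h : Cong p r x y) : Cong p r (-x) (-y) := by
  obtain ⟨a, ha, h⟩ := h
  exact ⟨-a, neg_mem ha, by linear_combination -h⟩

theorem sub (h : Cong p r x y) (h' : Cong p r x' y') : Cong p r (x - x') (y - y') := by
  simpa only [sub_eq_add_neg] using h.add h'.neg

theorem mul_left (h : Cong p r x y) (hw : w ∈ pInt p) : Cong p r (w * x) (w * y) := by
  obtain ⟨a, ha, h⟩ := h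
  exact ⟨w * a, mul_mem hw ha, by linear_combination w * h⟩

theorem mul_right (h : Cong p r x y) (hw : w ∈ pInt p) : Cong p r (x * w) (y * w) := by
  simpa only [mul_comm] using h.mul_left hw

theorem sum {ι : Type*} {s : Finset ι} {f g : ι → ℂ} (h : ∀ i ∈ s, Cong p r (f i) (g i)) :
    Cong p r (∑ i ∈ s, f i) (∑ i ∈ s, g i) := by
  classical
  induction s using Finset.induction_on with
  | empty => exact refl _
  | insert a s ha ih =>
    rw [sum_insert ha, sum_insert ha]
    exact (h a (mem_insert_self _ _)).add (ih fun i hi => h i (mem_insert_of_mem hi))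

theorem p_mul (h : Cong p r x y) : Cong p (r + 1) (p * x) (p * y) := by
  obtain ⟨a, ha, h⟩ := h
  exact ⟨a, ha, by linear_combination p * h⟩

theorem of_le {s : ℕ} (h : Cong p r x y) (hs : s ≤ r) : Cong p s x y := by
  obtain ⟨a, ha, h⟩ := h
  refine ⟨p ^ (r - s) * a, mul_mem (pow_mem (natCast_mem _ _) _) ha, ?_⟩
  rw [h, ← mul_assoc, ← pow_add]
  congr 2; omega

theorem cancel_left (hw : w ∈ pInt p) (hxy : Cong p r (z * x) (z * y)) (hwz : w * z = 1) :
    Cong p r x y := by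
  have := hxy.mul_left hw
  rwa [← mul_assoc, ← mul_assoc, hwz, one_mul, one_mul] at this

theorem of_int_dvd {a b : ℤ} (h : (p : ℤ) ^ r ∣ a - b) : Cong p r a b := by
  obtain ⟨k, hk⟩ := h
  exact ⟨k, intCast_mem _ _, by exact_mod_cast hk⟩

theorem of_zmod {a b : ℤ} (h : (a : ZMod p) = b) : Cong p 1 a b := by
  apply of_int_dvd
  rw [pow_one, ← ZMod.intCast_zmod_eq_zero_iff_dvd]
  simp [h]

end Cong

/-! ### The congruence modulo p for the sum weighted by k -/

theorem sum_range_zmod_eq {p : ℕ} [hp : Fact p.Prime] {A : Type*} [AddCommMonoid A] (f : ZMod p → A) :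
    ∑ n ∈ range p, f n = ∑ x : ZMod p, f x := by
  refine sum_nbij' (fun n => (n : ZMod p)) ZMod.val ?_ ?_ ?_ ?_ ?_
  · intro n _; simp
  · intro x _; simpa using ZMod.val_lt x
  · intro n hn; exact ZMod.val_cast_of_lt (mem_range.1 hn)
  · intro x _; simp
  · intro n _; rfl

theorem sum_range_eval_eq_zero {p : ℕ} [hp : Fact p.Prime] (P : (ZMod p)[X]) (h : P.natDegree < p - 1) :
    ∑ n ∈ range p, P.eval (n : ZMod p) = 0 := by
  rw [sum_range_zmod_eq (fun x => P.eval x)]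
  simp_rw [eval_eq_sum_range]
  rw [sum_comm]
  refine sum_eq_zero fun i hi => ?_
  rw [← mul_sum, FiniteField.sum_pow_lt_card_sub_one, mul_zero]
  rw [ZMod.card]
  have := mem_range.1 hi
  omega

theorem choose_pred_prime {p : ℕ} [hp : Fact p.Prime] (k : ℕ) (hk : k < p) :
    ((p - 1).choose k : ZMod p) = (-1) ^ k := by
  induction k with
  | zero => simp
  | succ k ih =>
    have h := Nat.choose_succ_succ' (p - 1) k
    have h1 : p - 1 + 1 = p := Nat.sub_add_cancel hp.out.one_le
    rw [h1] at h
    have h2 : (p.choose (k + 1) : ZMod p) = 0 := by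
      rw [ZMod.natCast_eq_zero_iff]
      exact hp.out.dvd_choose_self (by omega) hk
    rw [h] at h2
    push_cast at h2
    rw [ih (by omega)] at h2
    rw [pow_succ]
    linear_combination h2

/-- After multiplication by (j+1)! j!, which is a unit, the summand is a polynomial in n of degree
2j+1 < p-1. Power sums of such degree vanish over the field. -/
theorem sum_choose_mul_choose_eq_zero {p : ℕ} [hp : Fact p.Prime] (j : ℕ) (hj : 2 * j + 1 < p - 1) :
    ∑ n ∈ range p, (n.choose (j + 1) : ZMod p) * ((n + j + 1).choose j : ZMod p) = 0 := by
  have hf : ∀ k, k < p → (k.factorial : ZMod p) ≠ 0 := by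
    intro k hk h
    rw [ZMod.natCast_eq_zero_iff, hp.out.dvd_factorial] at h
    omega
  apply mul_left_cancel₀ (mul_ne_zero (hf (j + 1) (by omega)) (hf j (by omega)))
  rw [mul_zero, mul_sum,
    ← sum_range_eval_eq_zero (descPochhammer (ZMod p) (j + 1) *
      (descPochhammer (ZMod p) j).comp (X + C ((j + 1 : ℕ) : ZMod p)))]
  · refine sum_congr rfl fun n _ => ?_
    have e : (n : ZMod p) + ((j + 1 : ℕ) : ZMod p) = ((n + j + 1 : ℕ) : ZMod p) := by push_cast; ring
    rw [eval_mul, eval_comp, eval_add, eval_X, eval_C, e,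
      descPochhammer_eval_eq_descFactorial, descPochhammer_eval_eq_descFactorial,
      Nat.descFactorial_eq_factorial_mul_choose, Nat.descFactorial_eq_factorial_mul_choose]
    push_cast
    ring
  · refine lt_of_le_of_lt natDegree_mul_le ?_
    rw [natDegree_comp, natDegree_X_add_C, descPochhammer_natDegree, descPochhammer_natDegree]
    omega

/-- For n ≤ h the first binomial is zero. For h < n < p-1 the second is divisible by p, because
adding h and n+1 in base p carries. Only n = p-1 survives, evaluated by Lucas's theorem. -/
theorem sum_choose_mul_choose_half {p h : ℕ} [hp : Fact p.Prime] (hh : p = 2 * h + 1) (h0 : 0 < h) :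
    ∑ n ∈ range p, (n.choose (h + 1) : ZMod p) * ((n + h + 1).choose h : ZMod p) = -(-1) ^ h := by
  rw [sum_eq_single (p - 1)]
  · rw [choose_pred_prime _ (by omega), pow_succ]
    have e : p - 1 + h + 1 = p + h := by omega
    have h1 := Choose.choose_modEq_choose_mod_mul_choose_div_nat (n := p + h) (k := h) (p := p)
    have h2 : (p + h) / p = 1 := by
      rw [Nat.add_div_left _ (by omega), Nat.div_eq_of_lt (by omega)]
    rw [Nat.add_mod_left, h2, Nat.mod_eq_of_lt (by omega), Nat.div_eq_of_lt (show h < p by omega),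
      Nat.choose_self, Nat.choose_zero_right] at h1
    have h3 := (ZMod.natCast_eq_natCast_iff _ _ _).2 h1
    rw [e, h3]
    simp
  · intro n hn hn'
    have hn := mem_range.1 hn
    rcases lt_or_ge n (h + 1) with hlt | hge
    · rw [Nat.choose_eq_zero_of_lt hlt]; simp
    · have := hp.out.dvd_choose_add (a := h) (b := n + 1) (by omega) (by omega) (by omega)
      have e : h + (n + 1) = n + h + 1 := by ring
      rw [e] at this
      rw [(ZMod.natCast_eq_zero_iff _ _).2 this, mul_zero]
  · intro hn; exact absurd (mem_range.2 (by omega)) hn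

theorem catalan_zmod_half {p h : ℕ} [hp : Fact p.Prime] (hh : p = 2 * h + 1) :
    (catalan h : ZMod p) = 2 * (-1) ^ h := by
  have h1 := congrArg (Nat.cast : ℕ → ZMod p) (succ_mul_catalan_eq_centralBinom h)
  have h2 := choose_pred_prime (p := p) h (by omega)
  have e : p - 1 = 2 * h := by omega
  rw [e, ← Nat.centralBinom] at h2
  have h3 : (2 * h + 1 : ZMod p) = 0 := by
    have : ((2 * h + 1 : ℕ) : ZMod p) = 0 := by rw [← hh]; simp
    exact_mod_cast this
  push_cast at h1
  linear_combination 2 * h1 + 2 * h2 - catalan h * h3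

/-- Here p divides the central binomial but not j+1. At j = p-1 this fails, hence the bound on j. -/
theorem catalan_zmod_eq_zero {p h j : ℕ} [hp : Fact p.Prime] (hh : p = 2 * h + 1) (hj : h < j)
    (hj' : j < p - 1) : (catalan j : ZMod p) = 0 := by
  rw [ZMod.natCast_eq_zero_iff]
  have h1 := succ_mul_catalan_eq_centralBinom j
  have h2 := hp.out.dvd_choose_add (a := j) (b := j) (by omega) (by omega) (by omega)
  rw [← two_mul, ← Nat.centralBinom, ← h1, hp.out.dvd_mul] at h2
  exact h2.resolve_left (Nat.not_dvd_of_pos_of_lt (by omega) (by omega))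

theorem sum_mul_sub (r : ℕ → ℚ) (h0 : r 0 = 0) (N : ℕ) :
    ∑ k ∈ range N, (k : ℚ) * (r (k + 1) - r k) = (N : ℚ) * r N - ∑ n ∈ range (N + 1), r n := by
  induction N with
  | zero => simp [h0]
  | succ N ih =>
    rw [sum_range_succ, ih, sum_range_succ _ (N + 1)]
    push_cast; ring

/-- The number `n w(n,k+1) C_k` as a natural number. -/
def wCoeffNat (n k : ℕ) : ℕ := n.choose (k + 1) * (n + k + 1).choose k * catalan k

theorem wCoeffNat_cast (n k : ℕ) : (wCoeffNat n k : ℚ) = wCoeff n k := by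
  simp [wCoeffNat, wCoeff]

theorem prime_dvd_wCoeffNat {p : ℕ} (hp : 0 < p) (k : ℕ) : p ∣ wCoeffNat p k := by
  have h := mul_w p k
  rw [← wCoeffNat_cast, w_succ_eq_intCast p k hp] at h
  rw [← Int.natCast_dvd_natCast]
  exact ⟨_ * (catalan k : ℤ), by rw [← mul_assoc]; exact_mod_cast h.symm⟩

theorem sum_wCoeffNat_zmod {p h : ℕ} [hp : Fact p.Prime] (hh : p = 2 * h + 1) (h0 : 0 < h) {j : ℕ}
    (hj : j < p - 1) :
    ((∑ n ∈ range p, wCoeffNat n j : ℕ) : ZMod p) = if j = h then -2 else 0 := by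
  have e : ((∑ n ∈ range p, wCoeffNat n j : ℕ) : ZMod p) =
      (∑ n ∈ range p, (n.choose (j + 1) : ZMod p) * ((n + j + 1).choose j : ZMod p)) * catalan j := by
    simp [wCoeffNat, sum_mul]
  rw [e]
  rcases lt_trichotomy j h with hlt | rfl | hgt
  · rw [sum_choose_mul_choose_eq_zero j (by omega), if_neg hlt.ne]; simp
  · rw [sum_choose_mul_choose_half hh h0, catalan_zmod_half hh, if_pos rfl]
    have : ((-1 : ZMod p) ^ j) * (-1) ^ j = 1 := by rw [← mul_pow]; simp
    linear_combination -2 * this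
  · rw [catalan_zmod_eq_zero hh hgt hj, if_neg hgt.ne']; simp

theorem cong_half_pow {p h : ℕ} [hp : Fact p.Prime] (hh : p = 2 * h + 1) (c d : ℤ)
    (hd : ¬ (p : ℤ) ∣ d) : Cong p 1 (((c : ℂ) / d) ^ h) (legendreSym p (c * d)) := by
  have hd0 : (d : ℂ) ≠ 0 := by
    rintro h; apply hd; have : d = 0 := by exact_mod_cast h
    simp [this]
  have hd' : (d : ZMod p) ≠ 0 := by rwa [Ne, ZMod.intCast_zmod_eq_zero_iff_dvd]
  have h1 : Cong p 1 (c ^ h : ℤ) (legendreSym p (c * d) * d ^ h : ℤ) := by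
    apply Cong.of_zmod
    push_cast
    rw [legendreSym.eq_pow]
    have e : p / 2 = h := by omega
    have h2 : (d : ZMod p) ^ (2 * h) = 1 := by
      have := ZMod.pow_card_sub_one_eq_one hd'
      rwa [show p - 1 = 2 * h by omega] at this
    rw [e]
    push_cast
    rw [mul_pow]
    have h3 : (d : ZMod p) ^ h * d ^ h = 1 := by rw [← pow_add, ← two_mul]; exact h2
    linear_combination -(c : ZMod p) ^ h * h3
  have h2 := h1.mul_right (pow_mem (inv_intCast_mem hd) h)
  push_cast at h2
  convert h2 using 1
  · rw [div_pow, inv_pow]; rfl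
  · rw [mul_assoc, ← mul_pow, mul_inv_cancel₀ hd0, one_pow, mul_one]

theorem sum_k_mul_T_mul_M (b c d : ℤ) (hd : d = b ^ 2 - 4 * c) (p : ℕ) [hp : Fact p.Prime]
    (hp2 : p ≠ 2) (hpd : ¬ (p : ℤ) ∣ d) :
    RatModEq p
      (∑ k ∈ range p, (k : ℚ) * (T k b c : ℚ) * (M k b c : ℚ) / (d : ℚ) ^ k)
      (2 * (legendreSym p (c * d) : ℚ)) := by
  obtain ⟨h, hh⟩ : ∃ h, p = 2 * h + 1 := hp.out.odd_of_ne_two hp2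
  have h0 : 0 < h := by have := hp.out.two_le; omega
  have hd0 : d ≠ 0 := by rintro rfl; simp at hpd
  set y : ℚ := (c : ℚ) / d with hy
  set r : ℕ → ℚ := fun n => ∑ k ∈ range n, wCoeff n k * y ^ k with hr
  have hy' : (y : ℂ) ∈ pInt p := by
    rw [hy]; push_cast; rw [div_eq_mul_inv]
    exact mul_mem (intCast_mem _ _) (inv_intCast_mem hpd)
  have hstep : ∀ k : ℕ, (k : ℚ) * (T k b c : ℚ) * (M k b c : ℚ) / (d : ℚ) ^ k = k * (r (k + 1) - r k) := by
    intro k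
    rw [hr]
    simp only
    rw [← sum_T_mul_M_div b c d hd hd0, ← sum_T_mul_M_div b c d hd hd0, sum_range_succ]
    ring
  have hrp : Cong p 1 (r p : ℂ) 0 := by
    rw [hr]; push_cast
    rw [← sum_const_zero (s := range p)]
    refine Cong.sum fun k _ => ?_
    rw [← zero_mul ((y : ℂ) ^ k)]
    refine Cong.mul_right ?_ (pow_mem hy' k)
    obtain ⟨m, hm⟩ := prime_dvd_wCoeffNat hp.out.pos k
    rw [← wCoeffNat_cast, hm]
    exact ⟨m, natCast_mem _ _, by push_cast; ring⟩
  -- Since n ≤ p-1 and `wCoeff n j` vanishes for j ≥ n, the index j stops at p-2 and avoids the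
  -- exceptional Catalan number at p-1.
  have hsum : ∑ n ∈ range p, r n = ∑ j ∈ range (p - 1), ((∑ n ∈ range p, wCoeffNat n j : ℕ) : ℚ) * y ^ j := by
    have : ∀ n ∈ range p, r n = ∑ j ∈ range (p - 1), (wCoeffNat n j : ℚ) * y ^ j := by
      intro n hn
      rw [hr]
      simp only [wCoeffNat_cast]
      apply sum_subset
      · intro j hj; simp at hj hn ⊢; omega
      · intro j _ hj
        rw [wCoeff_eq_zero (by simpa using hj), zero_mul]
    rw [sum_congr rfl this, sum_comm]
    refine sum_congr rfl fun j _ => ?_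
    push_cast
    rw [sum_mul]
  have hsum' : Cong p 1 (∑ n ∈ range p, r n : ℚ) (-2 * (y : ℂ) ^ h) := by
    rw [hsum]
    have e : (-2 * (y : ℂ) ^ h) = ∑ j ∈ range (p - 1), ((if j = h then -2 else 0 : ℤ) : ℂ) * (y : ℂ) ^ j := by
      rw [sum_eq_single h]
      · simp
      · intro j _ hj; simp [hj]
      · intro hj; exfalso; apply hj; simp; omega
    rw [e]; push_cast
    refine Cong.sum fun j hj => Cong.mul_right ?_ (pow_mem hy' j)
    have h1 := sum_wCoeffNat_zmod hh h0 (mem_range.1 hj)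
    have : Cong p 1 ((∑ n ∈ range p, wCoeffNat n j : ℕ) : ℤ) (if j = h then -2 else 0 : ℤ) := by
      apply Cong.of_zmod
      push_cast at h1 ⊢
      exact h1
    push_cast at this
    exact this
  have key : Cong p 1 (∑ k ∈ range p, (k : ℚ) * (T k b c : ℚ) * (M k b c : ℚ) / (d : ℚ) ^ k : ℚ)
      (2 * (legendreSym p (c * d) : ℚ) : ℚ) := by
    rw [sum_congr rfl fun k _ => hstep k, sum_mul_sub r (by simp [hr]), sum_range_succ]
    have h1 := (hrp.mul_left (natCast_mem (pInt p) p)).sub (hsum'.add hrp)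
    have h2 := (cong_half_pow hh c d hpd).mul_left (natCast_mem (pInt p) 2)
    push_cast at h1 h2 ⊢
    refine h1.trans (Cong.trans (Cong.of_eq ?_) h2)
    rw [hy]; push_cast; ring
  simpa using key.ratModEq

/-! ### The numbers w(p,k) and C_{p-1} modulo p² -/

theorem w_one (n : ℕ) : w n 1 = 1 := by simp [w]

theorem w_add_two (n k : ℕ) (hk : k + 1 ≤ n) :
    w n (k + 2) * ((k + 1) * (k + 2)) = w n (k + 1) * ((n - (k + 1)) * (n + k + 2)) := by
  have h1 := congrArg (Nat.cast : ℕ → ℚ) (Nat.choose_succ_right_eq (n - 1) k)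
  have h2 := congrArg (Nat.cast : ℕ → ℚ) (Nat.add_one_mul_choose_eq (n + k + 1) k)
  have e : n - 1 - k = n - (k + 1) := by omega
  rw [e] at h1
  push_cast [Nat.cast_sub hk] at h1 h2
  have e1 : n + (k + 2) = n + k + 1 + 1 := by ring
  have e2 : k + 2 - 1 = k + 1 := by omega
  rw [w, w, e1, e2, Nat.add_sub_cancel, ← add_assoc]
  push_cast
  field_simp
  linear_combination ((n + k + 1 + 1).choose (k + 1) : ℚ) * (k + 1) * h1 -
    ((n - 1).choose k : ℚ) * (n - (k + 1)) * h2

/-- The ratio of consecutive terms is -1 + (p²+p)/((k+1)(k+2)), and 1/((k+1)(k+2)) telescopes. The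
bound keeps k+1 invertible, so w(p,p) needs separate treatment. -/
theorem w_cong {p : ℕ} [hp : Fact p.Prime] (k : ℕ) (hk : k + 1 < p) :
    Cong p 2 (w p (k + 1)) ((-1) ^ k * (1 - p + p * ((k + 1 : ℕ) : ℂ)⁻¹)) := by
  induction k with
  | zero => exact Cong.of_eq (by rw [w_one]; simp)
  | succ k ih =>
    obtain ⟨z, hz, h⟩ := ih (by omega)
    have hi : ((k + 1 : ℕ) : ℂ)⁻¹ ∈ pInt p := inv_natCast_mem_of_lt (by omega) (by omega)
    have hj : ((k + 1 + 1 : ℕ) : ℂ)⁻¹ ∈ pInt p := inv_natCast_mem_of_lt (by omega) (by omega)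
    have hi0 : ((k + 1 : ℕ) : ℂ) ≠ 0 := Nat.cast_ne_zero.2 (by omega)
    have hj0 : ((k + 1 + 1 : ℕ) : ℂ) ≠ 0 := Nat.cast_ne_zero.2 (by omega)
    have hij : ((k + 1 : ℕ) : ℂ)⁻¹ * ((k + 1 + 1 : ℕ) : ℂ)⁻¹ =
        ((k + 1 : ℕ) : ℂ)⁻¹ - ((k + 1 + 1 : ℕ) : ℂ)⁻¹ := by
      field_simp; push_cast; ring
    have hw : (w p (k + 1 + 1) : ℂ) = w p (k + 1) *
        (-1 + (p ^ 2 + p) * (((k + 1 : ℕ) : ℂ)⁻¹ * ((k + 1 + 1 : ℕ) : ℂ)⁻¹)) := by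
      have := congrArg (Rat.cast : ℚ → ℂ) (w_add_two p k (by omega))
      push_cast at this hi0 hj0 ⊢
      have hj0' : (k : ℂ) + 2 ≠ 0 := by convert hj0 using 1; ring
      field_simp
      rw [show (k : ℂ) + 1 + 1 = k + 2 by ring]
      linear_combination this
    set i := ((k + 1 : ℕ) : ℂ)⁻¹
    set j := ((k + 1 + 1 : ℕ) : ℂ)⁻¹
    have hpm := natCast_mem (pInt p) p
    refine ⟨z * (-1 + (p ^ 2 + p) * (i * j)) + (-1) ^ k * (i * j * (1 + (p + 1) * (i - 1))), ?_, ?_⟩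
    · have := one_mem (pInt p)
      apply_rules [add_mem, mul_mem, neg_mem, sub_mem, pow_mem]
    · rw [hw]
      linear_combination (-1 + (p ^ 2 + p) * (i * j)) * h + (-1) ^ k * p * hij

theorem w_self_cong {p : ℕ} [hp : Fact p.Prime] (hp2 : p ≠ 2) : Cong p 2 (w p p) (2 * (1 - p)) := by
  have h2 := hp.out.two_le
  obtain ⟨k, rfl⟩ : ∃ k, p = k + 2 := ⟨p - 2, by omega⟩
  have hodd : Odd k := by
    have := hp.out.odd_of_ne_two hp2
    rcases this with ⟨m, hm⟩
    exact ⟨m - 1, by omega⟩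
  obtain ⟨z, hz, h⟩ := w_cong (p := k + 2) k (by omega)
  have hi : ((k + 1 : ℕ) : ℂ)⁻¹ ∈ pInt (k + 2) := inv_natCast_mem_of_lt (by omega) (by omega)
  have hi0 : ((k + 1 : ℕ) : ℂ) ≠ 0 := Nat.cast_ne_zero.2 (by omega)
  have hii := mul_inv_cancel₀ hi0
  have hw : (w (k + 2) (k + 2) : ℂ) = 2 * ((k + 1 : ℕ) : ℂ)⁻¹ * w (k + 2) (k + 1) := by
    have := congrArg (Rat.cast : ℚ → ℂ) (w_add_two (k + 2) k (by omega))
    push_cast at this hi0 ⊢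
    have hk : (k : ℂ) + 2 ≠ 0 := by exact_mod_cast (Nat.succ_ne_zero (k + 1))
    field_simp
    apply mul_left_cancel₀ hk
    linear_combination this
  rw [hodd.neg_one_pow] at h
  set i := ((k + 1 : ℕ) : ℂ)⁻¹
  have hpp : (((k + 2 : ℕ) : ℂ) - 1) * i = 1 := by
    rw [show ((k + 2 : ℕ) : ℂ) - 1 = ((k + 1 : ℕ) : ℂ) by push_cast; ring]; exact hii
  have hpm := natCast_mem (pInt (k + 2)) (k + 2)
  rw [hw]
  set P := ((k + 2 : ℕ) : ℂ)
  refine ⟨2 * i * z - 2 * i ^ 2 - 2 * i * (1 - 2 * P) - 4, ?_, ?_⟩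
  · have h1 := one_mem (pInt (k + 2))
    have h2 : (2 : ℂ) ∈ pInt (k + 2) := natCast_mem _ 2
    have h4 : (4 : ℂ) ∈ pInt (k + 2) := natCast_mem _ 4
    apply_rules [add_mem, mul_mem, neg_mem, sub_mem, pow_mem]
  · linear_combination 2 * i * h + (2 + 2 * P * i - 2 * P - 4 * P ^ 2) * hpp

/-- Since w(p,p) = C_p, the Catalan recurrence (p+1) C_p = 2(2p-1) C_{p-1} transfers the previous
congruence. -/
theorem catalan_pred_prime_cong {p : ℕ} [hp : Fact p.Prime] (hp2 : p ≠ 2) :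
    Cong p 2 (catalan (p - 1)) (-1 - 2 * p) := by
  have h2 := hp.out.two_le
  have hrel : 2 * (2 * (p : ℂ) - 1) * catalan (p - 1) = (p + 1) * w p p := by
    obtain ⟨n, rfl⟩ : ∃ n, p = n + 1 := ⟨p - 1, by omega⟩
    have h1 := congrArg (Nat.cast : ℕ → ℂ) (succ_mul_catalan_eq_centralBinom n)
    have h2 := congrArg (Nat.cast : ℕ → ℂ) (Nat.succ_mul_centralBinom_succ n)
    have h3 := congrArg (Nat.cast : ℕ → ℂ) (Nat.choose_succ_right_eq (2 * (n + 1)) n)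
    rw [← Nat.centralBinom, show 2 * (n + 1) - n = n + 2 by omega] at h3
    rw [w]
    simp only [Nat.add_sub_cancel, Nat.choose_self]
    rw [← two_mul]
    push_cast at h1 h2 h3 ⊢
    have hn : (n : ℂ) + 1 ≠ 0 := by exact_mod_cast (Nat.succ_ne_zero n)
    field_simp
    linear_combination 2 * (2 * n + 1) * h1 - h2 + h3
  have hhalf : ((2 : ℕ) : ℂ)⁻¹ ∈ pInt p := inv_natCast_mem_of_lt (by omega) (by omega)
  have hpm := natCast_mem (pInt p) p
  have hcm := natCast_mem (pInt p) (catalan (p - 1))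
  obtain ⟨z, hz, h⟩ := w_self_cong hp2
  refine ⟨4 * catalan (p - 1) - ((2 : ℕ) : ℂ)⁻¹ * (2 * p + 1) * ((p + 1) * z - 2), ?_, ?_⟩
  · have h1 := one_mem (pInt p)
    have h2 : (2 : ℂ) ∈ pInt p := natCast_mem _ 2
    have h4 : (4 : ℂ) ∈ pInt p := natCast_mem _ 4
    apply_rules [add_mem, mul_mem, neg_mem, sub_mem, pow_mem]
  · push_cast
    linear_combination (-1 / 2 * (2 * p + 1 : ℂ)) * hrel + (-1 / 2 * (2 * p + 1 : ℂ)) * (p + 1) * h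

/-! ### Truncated central binomial sums modulo p² -/

/-- The partial sum of the first `n` terms of the binomial expansion of `(α + β)^m`. -/
def binomPartial (α β : ℂ) (m n : ℕ) : ℂ :=
  ∑ k ∈ range n, (m.choose k : ℂ) * (α ^ (m - k) * β ^ k)

theorem binomPartial_succ_right (α β : ℂ) (m n : ℕ) : binomPartial α β m (n + 1) =
    binomPartial α β m n + (m.choose n : ℂ) * (α ^ (m - n) * β ^ n) := sum_range_succ _ _

theorem binomPartial_succ_left (α β : ℂ) (m n : ℕ) (hn : n ≤ m) :
    binomPartial α β (m + 1) (n + 1) =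
      α * binomPartial α β m (n + 1) + β * binomPartial α β m n := by
  have h1 : binomPartial α β m (n + 1) =
      ∑ k ∈ range n, (m.choose (k + 1) : ℂ) * (α ^ (m - (k + 1)) * β ^ (k + 1)) + α ^ m := by
    rw [binomPartial, sum_range_succ']; simp
  rw [h1, binomPartial, sum_range_succ', binomPartial, mul_add, mul_sum, mul_sum]
  simp only [Nat.choose_zero_right, Nat.cast_one, Nat.sub_zero, pow_zero, mul_one, one_mul]
  rw [← pow_succ', add_right_comm, ← sum_add_distrib]
  congr 1
  refine sum_congr rfl fun k hk => ?_
  have hk := mem_range.1 hk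
  obtain ⟨q, rfl⟩ : ∃ q, m = q + k + 1 := ⟨m - k - 1, by omega⟩
  have e1 : q + k + 1 + 1 - (k + 1) = q + 1 := by omega
  have e2 : q + k + 1 - (k + 1) = q := by omega
  have e3 : q + k + 1 - k = q + 1 := by omega
  rw [Nat.choose_succ_succ', e1, e2, e3]
  push_cast; ring

/-- Multiplying twice by α+β = 1 changes the half expansion only by boundary terms at the cut. -/
theorem binomPartial_central_step (α β : ℂ) (h : α + β = 1) (n : ℕ) :
    binomPartial α β (2 * (n + 1)) (n + 1) = binomPartial α β (2 * n) n +
      α * (n.centralBinom * (α * β) ^ n) - ((2 * n + 1).choose n : ℂ) * (α * β) ^ (n + 1) := by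
  have h1 := binomPartial_succ_left α β (2 * n + 1) n (by omega)
  have h2 := binomPartial_succ_left α β (2 * n) n (by omega)
  have h3 := binomPartial_succ_right α β (2 * n + 1) n
  have h4 := binomPartial_succ_right α β (2 * n) n
  rw [show 2 * n + 1 - n = n + 1 by omega] at h3
  rw [show 2 * n - n = n by omega, ← Nat.centralBinom] at h4
  rw [show 2 * (n + 1) = 2 * n + 1 + 1 by ring, h1]
  have hx : β * binomPartial α β (2 * n + 1) n = β * binomPartial α β (2 * n + 1) (n + 1) -
      ((2 * n + 1).choose n : ℂ) * (α * β) ^ (n + 1) := by rw [h3, mul_pow]; ring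
  rw [hx, h2, mul_pow]
  linear_combination α * h4 +
    (α * binomPartial α β (2 * n) (n + 1) + β * binomPartial α β (2 * n) n + binomPartial α β (2 * n) n) * h

/-- Antisymmetrizing the previous step in α and β cancels its symmetric boundary term and leaves
(α-β) binom(2n,n) (αβ)^n. -/
theorem centralBinom_sum_identity (α β : ℂ) (h : α + β = 1) (n : ℕ) :
    (α - β) * ∑ k ∈ range n, (k.centralBinom : ℂ) * (α * β) ^ k =
      binomPartial α β (2 * n) n - binomPartial β α (2 * n) n := by
  induction n with
  | zero => simp [binomPartial]
  | succ n ih =>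
    rw [sum_range_succ, mul_add, ih, binomPartial_central_step α β h,
      binomPartial_central_step β α (by rw [add_comm]; exact h), mul_comm β α]
    ring

/-- In Vandermonde's convolution the two end terms give 2 binom(p,k), and each interior term
contains two factors p. -/
theorem prime_sq_dvd_choose_sub {p k : ℕ} [hp : Fact p.Prime] (h0 : 0 < k) (hk : k < p) :
    ((p : ℤ) ^ 2) ∣ ((2 * p).choose k : ℤ) - 2 * (p.choose k : ℤ) := by
  rw [two_mul p, Nat.add_choose_eq, Nat.sum_antidiagonal_eq_sum_range_succ_mk, sum_range_succ]
  obtain ⟨k, rfl⟩ := Nat.exists_eq_add_of_le' (show 1 ≤ k from h0)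
  rw [sum_range_succ']
  simp only [Nat.choose_zero_right, Nat.sub_self, Nat.sub_zero]
  push_cast
  rw [show ∀ a b : ℤ, a + 1 * b + b * 1 - 2 * b = a by intros; ring]
  refine dvd_sum fun i hi => ?_
  have hi := mem_range.1 hi
  rw [sq]
  exact mul_dvd_mul (by exact_mod_cast hp.out.dvd_choose_self (by omega) (by omega))
    (by exact_mod_cast hp.out.dvd_choose_self (by omega) (by omega))

theorem sum_choose_interior (α β : ℂ) (h : α + β = 1) {p : ℕ} (hp : 0 < p) :
    ∑ k ∈ range (p - 1), (p.choose (k + 1) : ℂ) * (α ^ (p - (k + 1)) * β ^ (k + 1)) =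
      1 - α ^ p - β ^ p := by
  obtain ⟨n, rfl⟩ := Nat.exists_eq_add_of_le' (show 1 ≤ p from hp)
  have h1 := add_pow β α (n + 1)
  rw [add_comm β α, h, one_pow, sum_range_succ, sum_range_succ'] at h1
  simp only [Nat.add_sub_cancel]
  simp at h1
  have : ∀ k, ((n + 1).choose (k + 1) : ℂ) * (α ^ (n + 1 - (k + 1)) * β ^ (k + 1)) =
     β ^ (k + 1) * α ^ (n - k) * ((n + 1).choose (k + 1)) := by
    intro k; rw [Nat.add_sub_add_right]; ring
  simp only [this]
  linear_combination -h1

/-- Replace binom(2p,k) by 2 binom(p,k) for 0 < k < p and factor out α^p. What remains is the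
interior of the expansion of (α+β)^p = 1. -/
theorem binomPartial_cong {p : ℕ} [hp : Fact p.Prime] {α β : ℂ} (hα : α ∈ pInt p) (hβ : β ∈ pInt p)
    (h : α + β = 1) : Cong p 2 (binomPartial α β (2 * p) p)
      (α ^ (2 * p) + 2 * α ^ p * (1 - α ^ p - β ^ p)) := by
  have hp0 := hp.out.pos
  have h1 : binomPartial α β (2 * p) p = ∑ k ∈ range (p - 1),
      ((2 * p).choose (k + 1) : ℂ) * (α ^ (2 * p - (k + 1)) * β ^ (k + 1)) + α ^ (2 * p) := by
    have : p = p - 1 + 1 := by omega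
    conv_lhs => rw [binomPartial]
    conv_lhs => arg 1; rw [this]
    rw [sum_range_succ']; simp
  rw [h1, ← sum_choose_interior α β h hp0, add_comm, mul_sum]
  refine (Cong.refl _).add (Cong.sum fun k hk => ?_)
  have hk := mem_range.1 hk
  have e : α ^ (2 * p - (k + 1)) = α ^ p * α ^ (p - (k + 1)) := by
    rw [← pow_add]; congr 1; omega
  rw [e]
  have h2 : Cong p 2 ((2 * p).choose (k + 1) : ℤ) (2 * (p.choose (k + 1)) : ℤ) :=
    Cong.of_int_dvd (by exact_mod_cast prime_sq_dvd_choose_sub (p := p) (k := k + 1) (by omega) (by omega))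
  have h3 := h2.mul_right (mul_mem (mul_mem (pow_mem hα p) (pow_mem hα (p - (k + 1)))) (pow_mem hβ (k + 1)))
  push_cast at h3
  convert h3 using 1
  all_goals ring

/-- `(α - β)^2 ∑_{k<p} binom(2k,k) (αβ)^k` modulo `p^2`, for `α + β = 1`. -/
theorem centralBinom_sum_cong {p : ℕ} [hp : Fact p.Prime] {α β : ℂ} (hα : α ∈ pInt p) (hβ : β ∈ pInt p)
    (h : α + β = 1) :
    Cong p 2 ((1 - 4 * (α * β)) * ∑ k ∈ range p, (k.centralBinom : ℂ) * (α * β) ^ k)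
      ((α - β) * (α ^ p - β ^ p) * (2 - (α ^ p + β ^ p))) := by
  have h1 := ((binomPartial_cong hα hβ h).sub
    (binomPartial_cong hβ hα (by rw [add_comm]; exact h))).mul_left (sub_mem hα hβ)
  rw [← centralBinom_sum_identity α β h] at h1
  convert h1 using 1
  · have : 1 - 4 * (α * β) = (α - β) * (α - β) := by linear_combination -(1 + α + β) * h
    rw [this, mul_assoc]
  · rw [pow_mul', pow_mul']; ring

/-! ### Truncated Catalan sums reduced to central binomial sums -/

/-- The induction rests on binom(2n+2,n+1) = 4 binom(2n,n) - 2C_n. -/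
theorem two_mul_sum_catalan (x : ℂ) (n : ℕ) : 2 * x * ∑ j ∈ range n, (catalan j : ℂ) * x ^ j =
    1 - (1 - 4 * x) * ∑ k ∈ range (n + 1), (k.centralBinom : ℂ) * x ^ k
      - 4 * x ^ (n + 1) * n.centralBinom := by
  induction n with
  | zero => simp
  | succ n ih =>
    have h1 := congrArg (Nat.cast : ℕ → ℂ) (succ_mul_catalan_eq_centralBinom n)
    have h2 := congrArg (Nat.cast : ℕ → ℂ) (Nat.succ_mul_centralBinom_succ n)
    have hn : (n : ℂ) + 1 ≠ 0 := by exact_mod_cast Nat.succ_ne_zero n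
    push_cast at h1 h2
    have h3 : ((n + 1).centralBinom : ℂ) = 2 * (2 * n + 1) * catalan n := by
      apply mul_left_cancel₀ hn
      linear_combination h2 - 2 * (2 * n + 1) * h1
    rw [sum_range_succ, mul_add, ih, sum_range_succ _ (n + 1), h3, ← h1]
    ring

/-- Termwise, C_j/(j+1) = 2C_j - binom(2j+2,j+1)/(2(j+1)). -/
theorem sum_catalan_div (x : ℂ) (n : ℕ) :
    x * ∑ j ∈ range n, (catalan j : ℂ) * ((j + 1 : ℕ) : ℂ)⁻¹ * x ^ j =
      2 * x * ∑ j ∈ range n, (catalan j : ℂ) * x ^ j -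
      1 / 2 * ∑ j ∈ range n, ((j + 1).centralBinom : ℂ) * ((j + 1 : ℕ) : ℂ)⁻¹ * x ^ (j + 1) := by
  rw [mul_sum, mul_sum, mul_sum, ← sum_sub_distrib]
  refine sum_congr rfl fun n _ => ?_
  have h1 := congrArg (Nat.cast : ℕ → ℂ) (succ_mul_catalan_eq_centralBinom n)
  have h2 := congrArg (Nat.cast : ℕ → ℂ) (Nat.succ_mul_centralBinom_succ n)
  have hn : (n : ℂ) + 1 ≠ 0 := by exact_mod_cast Nat.succ_ne_zero n
  push_cast at h1 h2
  have h3 : ((n + 1).centralBinom : ℂ) = 2 * (2 * n + 1) * catalan n := by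
    apply mul_left_cancel₀ hn
    linear_combination h2 - 2 * (2 * n + 1) * h1
  rw [h3]; push_cast; field_simp; ring

/-! ### Expansion of α^p + β^p in powers of αβ -/

/-- `∑ binom(n-k,k) (-x)^k`. -/
def fibPoly (x : ℂ) (n : ℕ) : ℂ := ∑ k ∈ range (n + 1), ((n - k).choose k : ℂ) * (-x) ^ k

theorem fibPoly_succ (x : ℂ) (n : ℕ) : fibPoly x (n + 1) =
    ∑ k ∈ range (n + 1), ((n - k).choose (k + 1) : ℂ) * (-x) ^ (k + 1) + 1 := by
  rw [fibPoly, sum_range_succ']; simp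

theorem fibPoly_add_two (x : ℂ) (n : ℕ) :
    fibPoly x (n + 2) = fibPoly x (n + 1) - x * fibPoly x n := by
  rw [fibPoly_succ x (n + 1), fibPoly_succ x n, sum_range_succ, fibPoly, mul_sum]
  simp only [Nat.sub_self, Nat.choose_zero_succ, Nat.cast_zero, zero_mul, add_zero]
  rw [add_sub_right_comm, ← sum_sub_distrib]
  congr 1
  refine sum_congr rfl fun k hk => ?_
  have hk := mem_range.1 hk
  rw [show n + 1 - k = (n - k) + 1 by omega, Nat.choose_succ_succ']
  push_cast; ring

/-- At x = αβ, `fibPoly` is the complete homogeneous sum Σ α^i β^(n-i), so this is the usual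
relation between the two kinds of Lucas sequence. -/
theorem pow_add_pow_eq_fibPoly (α β : ℂ) (h : α + β = 1) (n : ℕ) :
    α ^ (n + 2) + β ^ (n + 2) = fibPoly (α * β) (n + 2) - α * β * fibPoly (α * β) n := by
  have hβ : β = 1 - α := by linear_combination h
  have key : ∀ n, (α ^ (n + 2) + β ^ (n + 2) = fibPoly (α * β) (n + 2) - α * β * fibPoly (α * β) n) ∧
     (α ^ (n + 3) + β ^ (n + 3) = fibPoly (α * β) (n + 3) - α * β * fibPoly (α * β) (n + 1)) := by
    intro n
    induction n with
    | zero =>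
      have h0 : fibPoly (α * β) 0 = 1 := by simp [fibPoly]
      have h1 : fibPoly (α * β) (0 + 1) = 1 := by rw [fibPoly_succ]; simp
      have h2 := fibPoly_add_two (α * β) 0
      have h3 := fibPoly_add_two (α * β) (0 + 1)
      rw [show 0 + 1 + 2 = 0 + 3 by ring, show 0 + 1 + 1 = 0 + 2 by ring] at h3
      rw [h3, h2, h1, h0, hβ]
      constructor <;> ring
    | succ n ih =>
      refine ⟨ih.2, ?_⟩
      have e1 := fibPoly_add_two (α * β) (n + 2)
      have e2 := fibPoly_add_two (α * β) n
      obtain ⟨i1, i2⟩ := ih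
      have hr : ∀ m, α ^ (m + 2) + β ^ (m + 2) = (α ^ (m + 1) + β ^ (m + 1)) - α * β * (α ^ m + β ^ m) := by
        intro m; rw [hβ]; ring
      have := hr (n + 2)
      rw [show n + 1 + 3 = n + 2 + 2 by ring, this, show n + 2 + 1 = n + 3 by ring, i1, i2,
        show n + 1 + 1 = n + 2 by ring]
      rw [show n + 2 + 1 = n + 3 by ring] at e1
      rw [e1, e2]; ring
  exact (key n).1

theorem pow_add_pow_eq_one_add (α β : ℂ) (h : α + β = 1) {p : ℕ} (hp : 2 ≤ p) :
    α ^ p + β ^ p = 1 + p * ∑ k ∈ range (p - 1),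
      ((p - 2 - k).choose k : ℂ) * ((k + 1 : ℕ) : ℂ)⁻¹ * (-(α * β)) ^ (k + 1) := by
  obtain ⟨n, rfl⟩ := Nat.exists_eq_add_of_le' hp
  rw [pow_add_pow_eq_fibPoly α β h, fibPoly_succ _ (n + 1), sum_range_succ, fibPoly, mul_sum, mul_sum]
  simp only [Nat.sub_self, Nat.choose_zero_succ, Nat.cast_zero, zero_mul, add_zero]
  rw [add_sub_right_comm, ← sum_sub_distrib, add_comm, show n + 2 - 1 = n + 1 by omega]
  congr 1
  refine sum_congr rfl fun k hk => ?_
  have hk := mem_range.1 hk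
  have h1 := congrArg (Nat.cast : ℕ → ℂ) (Nat.add_one_mul_choose_eq (n - k) k)
  rw [show n + 1 - k = (n - k) + 1 by omega, show n + 2 - 2 - k = n - k by omega]
  push_cast [Nat.cast_sub (show k ≤ n by omega)] at h1 ⊢
  have hn : (k : ℂ) + 1 ≠ 0 := by exact_mod_cast Nat.succ_ne_zero k
  field_simp
  rw [pow_succ]
  linear_combination ((-(α * β)) ^ k * (α * β)) * h1

/-- Since p-2-k ≡ -(k+2), upper negation gives (-1)^k binom(2k+1,k), half of a central binomial up
to sign. -/
theorem choose_sub_zmod {p k : ℕ} [hp : Fact p.Prime] (hk : k + 1 < p) :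
    2 * ((p - 2 - k).choose k : ZMod p) = (-1) ^ k * ((k + 1).centralBinom : ZMod p) := by
  have hf : (k.factorial : ZMod p) ≠ 0 := by
    intro h
    rw [ZMod.natCast_eq_zero_iff, hp.out.dvd_factorial] at h
    omega
  apply mul_left_cancel₀ hf
  have h1 := ascPochhammer_eval_neg_eq_descPochhammer (R := ZMod p) (-((k + 2 : ℕ) : ZMod p)) k
  have e1 : -((k + 2 : ℕ) : ZMod p) = ((p - 2 - k : ℕ) : ZMod p) := by
    have : ((p - 2 - k + (k + 2) : ℕ) : ZMod p) = 0 := by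
      rw [show p - 2 - k + (k + 2) = p by omega]; simp
    rw [Nat.cast_add] at this
    linear_combination -this
  rw [neg_neg, e1, descPochhammer_eval_eq_descFactorial, ascPochhammer_nat_eq_natCast_descFactorial,
    Nat.descFactorial_eq_factorial_mul_choose, Nat.descFactorial_eq_factorial_mul_choose,
    show k + 2 + k - 1 = 2 * k + 1 by omega] at h1
  have h2 : (k + 1).centralBinom = 2 * (2 * k + 1).choose k := by
    rw [Nat.centralBinom, show 2 * (k + 1) = 2 * k + 1 + 1 by ring, Nat.choose_succ_succ',
      Nat.choose_symm_half]
    ring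
  have h3 : ((-1 : ZMod p) ^ k) * (-1) ^ k = 1 := by rw [← mul_pow]; simp
  rw [h2]
  push_cast at h1 ⊢
  linear_combination -2 * (-1) ^ k * h1 - 2 * k.factorial * (p - 2 - k).choose k * h3

/-- `α^p + β^p` modulo `p^2`, for `α + β = 1`, in terms of a truncated logarithm. -/
theorem pow_add_pow_cong {p : ℕ} [hp : Fact p.Prime] (hp2 : p ≠ 2) {α β : ℂ} (hα : α ∈ pInt p)
    (hβ : β ∈ pInt p) (h : α + β = 1) : ∃ e ∈ pInt p, α ^ p + β ^ p = 1 + p * e ∧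
      Cong p 1 (-(1 / 2) * ∑ j ∈ range (p - 1),
        ((j + 1).centralBinom : ℂ) * ((j + 1 : ℕ) : ℂ)⁻¹ * (α * β) ^ (j + 1)) e := by
  have h2 := hp.out.two_le
  have hx := mul_mem hα hβ
  have hinv : ∀ k ∈ range (p - 1), ((k + 1 : ℕ) : ℂ)⁻¹ ∈ pInt p := fun k hk =>
    inv_natCast_mem_of_lt (by omega) (by have := mem_range.1 hk; omega)
  refine ⟨_, ?_, pow_add_pow_eq_one_add α β h h2, ?_⟩
  · exact sum_mem fun k hk => mul_mem (mul_mem (natCast_mem _ _) (hinv k hk)) (pow_mem (neg_mem hx) _)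
  · rw [mul_sum]
    refine Cong.sum fun k hk => ?_
    have h1 : Cong p 1 (2 * (p - 2 - k).choose k : ℤ) ((-1) ^ k * (k + 1).centralBinom : ℤ) := by
      apply Cong.of_zmod
      push_cast
      exact choose_sub_zmod (by have := mem_range.1 hk; omega)
    have hhalf : ((2 : ℕ) : ℂ)⁻¹ ∈ pInt p := inv_natCast_mem_of_lt (by omega) (by omega)
    have h3 := h1.symm.mul_right (mul_mem (mul_mem hhalf (hinv k hk)) (pow_mem (neg_mem hx) (k + 1)))
    have h4 : ((-1 : ℂ) ^ k) * (-1) ^ k = 1 := by rw [← mul_pow]; simp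
    push_cast at h3 ⊢
    convert h3 using 1
    · rw [neg_pow (α * β), pow_succ (-1 : ℂ)]
      linear_combination (1 / 2 * ((k + 1).centralBinom : ℂ) * ((k : ℂ) + 1)⁻¹ * (α * β) ^ (k + 1)) * h4
    · ring

/-! ### The sum of w(p,j+1) C_j (-αβ)^j modulo p² -/

theorem sum_w_cong_split {p : ℕ} [hp : Fact p.Prime] {x : ℂ} (hx : x ∈ pInt p) :
    Cong p 2 (∑ j ∈ range (p - 1), (w p (j + 1) : ℂ) * catalan j * (-x) ^ j)
      ((1 - p) * ∑ j ∈ range (p - 1), (catalan j : ℂ) * x ^ j +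
        p * ∑ j ∈ range (p - 1), (catalan j : ℂ) * ((j + 1 : ℕ) : ℂ)⁻¹ * x ^ j) := by
  rw [mul_sum, mul_sum, ← sum_add_distrib]
  refine Cong.sum fun j hj => ?_
  have hj := mem_range.1 hj
  have h1 := (w_cong (p := p) j (by omega)).mul_right
    (mul_mem (natCast_mem _ (catalan j)) (pow_mem (neg_mem hx) j))
  have h4 : ((-1 : ℂ) ^ j) * (-1) ^ j = 1 := by rw [← mul_pow]; simp
  rw [mul_assoc]
  refine h1.trans (Cong.of_eq ?_)
  rw [neg_pow x]
  linear_combination ((1 - p + p * ((j + 1 : ℕ) : ℂ)⁻¹) * catalan j * x ^ j) * h4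

/-- Write a = α^p, b = β^p and a+b = 1+pe. The boundary terms at the top index combine to -4ab =
(a-b)² - (a+b)² mod p². Then -(a+b)² ≡ -1-2pe cancels the truncated logarithm 2pe, so only a±b
survive. -/
theorem sum_w_catalan_cong {p : ℕ} [hp : Fact p.Prime] (hp2 : p ≠ 2) {α β : ℂ} (hα : α ∈ pInt p)
    (hβ : β ∈ pInt p) (h : α + β = 1) :
    Cong p 2 (2 * (α * β) * ∑ j ∈ range p, (w p (j + 1) : ℂ) * catalan j * (-(α * β)) ^ j)
      ((α ^ p - β ^ p) ^ 2 + p - (α - β) * (α ^ p - β ^ p) * (2 + p - (α ^ p + β ^ p))) := by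
  have h2 := hp.out.two_le
  have hx := mul_mem hα hβ
  obtain ⟨z1, hz1, hQ⟩ := sum_w_cong_split (p := p) hx
  obtain ⟨z2, hz2, hW⟩ := w_self_cong (p := p) hp2
  obtain ⟨z3, hz3, hC⟩ := catalan_pred_prime_cong (p := p) hp2
  obtain ⟨z4, hz4, hS⟩ := centralBinom_sum_cong hα hβ h
  obtain ⟨e, he, hv, z5, hz5, hL⟩ := pow_add_pow_cong hp2 hα hβ h
  have hE := sum_catalan_div (α * β) (p - 1)
  have hA := two_mul_sum_catalan (α * β) (p - 1)
  have hB : ((p - 1).centralBinom : ℂ) = p * catalan (p - 1) := by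
    have := congrArg (Nat.cast : ℕ → ℂ) (succ_mul_catalan_eq_centralBinom (p - 1))
    rw [Nat.sub_add_cancel hp.out.one_le] at this
    rw [← this]; push_cast; ring
  rw [Nat.sub_add_cancel hp.out.one_le, hB] at hA
  have hsplit : ∑ j ∈ range p, (w p (j + 1) : ℂ) * catalan j * (-(α * β)) ^ j =
      ∑ j ∈ range (p - 1), (w p (j + 1) : ℂ) * catalan j * (-(α * β)) ^ j +
        w p p * catalan (p - 1) * (α * β) ^ (p - 1) := by
    obtain ⟨m, hm⟩ := hp.out.odd_of_ne_two hp2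
    have e1 : p = p - 1 + 1 := by omega
    conv_lhs => arg 1; rw [e1]
    rw [sum_range_succ, ← e1]
    congr 2
    exact Even.neg_pow ⟨m, by omega⟩ _
  have hX : (α * β) * (α * β) ^ (p - 1) = α ^ p * β ^ p := by
    rw [← pow_succ', Nat.sub_add_cancel hp.out.one_le, mul_pow]
  rw [hsplit]
  rw [mul_pow α β p] at hA
  have hpm := natCast_mem (pInt p) p
  have hcm := natCast_mem (pInt p) (catalan (p - 1))
  have ham := pow_mem hα p
  have hbm := pow_mem hβ p
  generalize (catalan (p - 1) : ℂ) = C at *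
  generalize (w p p : ℂ) = W at *
  generalize α ^ p = a at *
  generalize β ^ p = b at *
  refine ⟨-e ^ 2 + e * ((α - β) * (a - b)) + a * b * (16 + z3 * (4 - 8 * p) + C * (2 * z2 - 4))
    - (1 + p) * z4 + 2 * z5 + 2 * (α * β) * z1, ?_, ?_⟩
  · have i1 := one_mem (pInt p)
    have i2 : (2 : ℂ) ∈ pInt p := natCast_mem _ 2
    have i4 : (4 : ℂ) ∈ pInt p := natCast_mem _ 4
    have i8 : (8 : ℂ) ∈ pInt p := natCast_mem _ 8
    have i16 : (16 : ℂ) ∈ pInt p := natCast_mem _ 16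
    refine add_mem ?_ (mul_mem (mul_mem i2 hx) hz1)
    apply_rules [add_mem, mul_mem, neg_mem, sub_mem, pow_mem]
  · linear_combination 2 * (α * β) * hQ + 2 * p * hE + 2 * p * hL + (1 + p) * hA - (1 + p) * hS +
      2 * a * b * C * hW + a * b * (4 - 8 * p) * hC +
      (p * ((α - β) * (a - b)) - (a + b) - 1 - p * e) * hv + 2 * W * C * hX

/-! ### Lucas numbers, Fermat quotients and the final comparison -/

theorem u_mul_sub (A B : ℤ) (ρ σ : ℂ) (h1 : ρ + σ = A) (h2 : ρ * σ = B) (n : ℕ) :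
    (u A B n : ℂ) * (ρ - σ) = ρ ^ n - σ ^ n := by
  induction n using Nat.twoStepInduction with
  | zero => simp [u]
  | one => simp [u]
  | more n ih1 ih2 =>
    rw [u]
    push_cast
    rw [← h1, ← h2]
    linear_combination (ρ + σ) * ih2 - ρ * σ * ih1

theorem fermatQuotient_mem {p : ℕ} [hp : Fact p.Prime] {z : ℤ} (hz : ¬ (p : ℤ) ∣ z) :
    (fermatQuotient p z : ℂ) ∈ pInt p := by
  have hz' : (z : ZMod p) ≠ 0 := by rwa [Ne, ZMod.intCast_zmod_eq_zero_iff_dvd]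
  have h1 : ((z ^ (p - 1) - 1 : ℤ) : ZMod p) = 0 := by
    push_cast; rw [ZMod.pow_card_sub_one_eq_one hz', sub_self]
  obtain ⟨k, hk⟩ := (ZMod.intCast_zmod_eq_zero_iff_dvd _ _).1 h1
  have hp0 : (p : ℂ) ≠ 0 := Nat.cast_ne_zero.2 hp.out.ne_zero
  have : (fermatQuotient p z : ℂ) = k := by
    have hk' : (z : ℂ) ^ (p - 1) - 1 = p * k := by exact_mod_cast hk
    rw [fermatQuotient]; push_cast; rw [hk']; field_simp
  rw [this]; exact intCast_mem _ _

theorem pow_prime_eq_mul {p : ℕ} [hp : Fact p.Prime] (z : ℤ) :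
    (z : ℂ) ^ p = z * (1 + p * fermatQuotient p z) := by
  have hp0 : (p : ℂ) ≠ 0 := Nat.cast_ne_zero.2 hp.out.ne_zero
  rw [fermatQuotient]; push_cast
  rw [mul_div_cancel₀ _ hp0, add_sub_cancel, ← pow_succ', Nat.sub_add_cancel hp.out.one_le]

theorem sub_pow_prime_cong {p : ℕ} [hp : Fact p.Prime] (hp2 : p ≠ 2) {α β : ℂ} (hα : α ∈ pInt p)
    (hβ : β ∈ pInt p) : Cong p 1 (α ^ p - β ^ p) ((α - β) ^ p) := by
  obtain ⟨r, hr⟩ := exists_add_pow_prime_eq hp.out (⟨α, hα⟩ : pInt p) (⟨-β, neg_mem hβ⟩)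
  have hr' := congrArg (Subtype.val) hr
  push_cast at hr'
  rw [(hp.out.odd_of_ne_two hp2).neg_pow] at hr'
  refine ⟨α * β * r, mul_mem (mul_mem hα hβ) r.2, ?_⟩
  rw [sub_eq_add_neg α β]
  linear_combination -hr'

/-- Lucas numbers at `p - 1`, in terms of `α^p ± β^p`. -/
theorem u_pred_eq {p : ℕ} (hp : 0 < p) {b c : ℤ} {d δ v g : ℂ} (hd : d = b ^ 2 - 4 * c)
    (hδ : d * δ ^ 2 = b ^ 2) (hd0 : d ≠ 0) (hδ0 : δ ≠ 0)
    (ha : ((1 + δ) / 2) ^ p = (v + δ * g) / 2) (hb : ((1 - δ) / 2) ^ p = (v - δ * g) / 2) :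
    (u (b ^ 2 - 2 * c) (c ^ 2) (p - 1) : ℂ) * (4 * c ^ 2) = d ^ p * ((g - v) * (v - δ ^ 2 * g)) := by
  have h1 := u_mul_sub (b ^ 2 - 2 * c) (c ^ 2) (d * ((1 + δ) / 2) ^ 2) (d * ((1 - δ) / 2) ^ 2)
    (by push_cast; linear_combination hδ / 2 + hd / 2)
    (by push_cast
        have h2 : d * (1 - δ ^ 2) = -4 * c := by linear_combination hd - hδ
        linear_combination (d * (1 - δ ^ 2) - 4 * c) / 16 * h2) (p - 1)
  have hx : d * ((1 + δ) / 2 * ((1 - δ) / 2)) = -c := by linear_combination hd / 4 - hδ / 4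
  have e1 : (d * ((1 + δ) / 2) ^ 2) ^ (p - 1) * (d ^ 2 * ((1 + δ) / 2 * ((1 - δ) / 2)) ^ 2) =
      d ^ p * d * (((v + δ * g) / 2) ^ 2 * ((1 - δ) / 2) ^ 2) := by
    rw [← ha]
    obtain ⟨n, rfl⟩ := Nat.exists_eq_add_of_le' (show 1 ≤ p from hp)
    simp only [Nat.add_sub_cancel]
    generalize (1 + δ) / 2 = A
    generalize (1 - δ) / 2 = B
    ring
  have e2 : (d * ((1 - δ) / 2) ^ 2) ^ (p - 1) * (d ^ 2 * ((1 + δ) / 2 * ((1 - δ) / 2)) ^ 2) =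
      d ^ p * d * (((v - δ * g) / 2) ^ 2 * ((1 + δ) / 2) ^ 2) := by
    rw [← hb]
    obtain ⟨n, rfl⟩ := Nat.exists_eq_add_of_le' (show 1 ≤ p from hp)
    simp only [Nat.add_sub_cancel]
    generalize (1 + δ) / 2 = A
    generalize (1 - δ) / 2 = B
    ring
  have h3 : d ^ 2 * ((1 + δ) / 2 * ((1 - δ) / 2)) ^ 2 = c ^ 2 := by
    rw [← mul_pow, hx]; ring
  rw [h3] at e1 e2
  apply mul_left_cancel₀ (mul_ne_zero hd0 hδ0)
  linear_combination 4 * c ^ 2 * h1 + 4 * e1 - 4 * e2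

/-- Lucas numbers at `p + 1`, in terms of `α^p ± β^p`. -/
theorem u_succ_eq {p : ℕ} {b c : ℤ} {d δ v g : ℂ} (hd : d = b ^ 2 - 4 * c)
    (hδ : d * δ ^ 2 = b ^ 2) (hd0 : d ≠ 0) (hδ0 : δ ≠ 0)
    (ha : ((1 + δ) / 2) ^ p = (v + δ * g) / 2) (hb : ((1 - δ) / 2) ^ p = (v - δ * g) / 2) :
    (u (b ^ 2 - 2 * c) (c ^ 2) (p + 1) : ℂ) * 4 = d ^ p * ((v + g) * (v + δ ^ 2 * g)) := by
  have h1 := u_mul_sub (b ^ 2 - 2 * c) (c ^ 2) (d * ((1 + δ) / 2) ^ 2) (d * ((1 - δ) / 2) ^ 2)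
    (by push_cast; linear_combination hδ / 2 + hd / 2)
    (by push_cast
        have h2 : d * (1 - δ ^ 2) = -4 * c := by linear_combination hd - hδ
        linear_combination (d * (1 - δ ^ 2) - 4 * c) / 16 * h2) (p + 1)
  have e1 : (d * ((1 + δ) / 2) ^ 2) ^ (p + 1) = d ^ p * d * (((v + δ * g) / 2) ^ 2 * ((1 + δ) / 2) ^ 2) := by
    rw [← ha]; generalize (1 + δ) / 2 = A; ring
  have e2 : (d * ((1 - δ) / 2) ^ 2) ^ (p + 1) = d ^ p * d * (((v - δ * g) / 2) ^ 2 * ((1 - δ) / 2) ^ 2) := by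
    rw [← hb]; generalize (1 - δ) / 2 = B; ring
  apply mul_left_cancel₀ (mul_ne_zero hd0 hδ0)
  linear_combination 4 * h1 + 4 * e1 - 4 * e2

/-- The final congruence modulo `P^2`, with its explicit quotient. -/
theorem target_identity {P b c d δ e f qc qd ε K₀ : ℂ} (hP : P ≠ 0) (hc : c ≠ 0) (hd0 : d ≠ 0)
    (hε : ε ^ 2 = 1) (hd : d = b ^ 2 - 4 * c) (hδ : d * δ ^ 2 = b ^ 2)
    (hK : 4 * c ^ 2 * K₀ = P * (e - f) * (4 * c - P * (-4 * c * qd + (1 + P * qd) * d * (e - δ ^ 2 * f))))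
    (hR : (1 + P * qd) * (d * (1 + P * e) ^ 2 - b ^ 2 * (1 + P * f) ^ 2) + 4 * c * (1 + P * qc) = 0) :
    (δ * (ε * (1 + P * f))) ^ 2 + P - δ * (δ * (ε * (1 + P * f))) * (2 + P - (1 + P * e)) -
      2 * (-(c / d)) * (b ^ 2 / (2 * c) * (ε - 1) + P / (2 * c) * (b ^ 2 * (qd - qc + ε) - d)
        - b ^ 2 * (2 * c + d * ε) * (ε * K₀) / (4 * c)) =
    P ^ 2 * (δ ^ 2 * ((d * e ^ 2 - b ^ 2 * f ^ 2 + qd * (2 * d * e - 2 * b ^ 2 * f)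
        + P * qd * (d * e ^ 2 - b ^ 2 * f ^ 2)) * 4⁻¹ * c⁻¹ + f ^ 2 - ε * f * (1 - e)
        + (2 * c * ε + d) * (e - f) * (-4 * c * qd + (1 + P * qd) * d * (e - δ ^ 2 * f))
          * 8⁻¹ * (c⁻¹) ^ 2)) := by
  -- In `hR` the constant term d - b² + 4c vanishes. Dividing by 2P leaves a linear relation between
  -- e, f and the Fermat quotients, up to a multiple of P.
  have hR1 : d * e - b ^ 2 * f + 2 * c * (qc - qd) = -P * (d * e ^ 2 - b ^ 2 * f ^ 2 +
      qd * (2 * d * e - 2 * b ^ 2 * f) + P * qd * (d * e ^ 2 - b ^ 2 * f ^ 2)) / 2 := by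
    apply mul_left_cancel₀ hP
    linear_combination hR / 2 - (1 + P * qd) / 2 * hd
  have hT : 2 * (-(c / d)) * (b ^ 2 / (2 * c) * (ε - 1) + P / (2 * c) * (b ^ 2 * (qd - qc + ε) - d)
        - b ^ 2 * (2 * c + d * ε) * (ε * K₀) / (4 * c)) =
      -(δ ^ 2 * (ε - 1)) - P * (δ ^ 2 * (qd - qc + ε) - 1) + δ ^ 2 * (2 * c + d * ε) * (ε * K₀) / 2 := by
    rw [← hδ]; field_simp; ring
  rw [hT]
  have hK' : K₀ = P * (e - f) * (4 * c - P * (-4 * c * qd + (1 + P * qd) * d * (e - δ ^ 2 * f))) /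
      (4 * c ^ 2) := by
    rw [eq_div_iff (by simpa using hc)]; linear_combination hK
  set Y := -4 * c * qd + (1 + P * qd) * d * (e - δ ^ 2 * f)
  have hεK : δ ^ 2 * (2 * c + d * ε) * (ε * K₀) / 2 = δ ^ 2 * (2 * c * ε + d) * K₀ / 2 := by
    linear_combination δ ^ 2 * d * K₀ / 2 * hε
  have hεg : (δ * (ε * (1 + P * f))) ^ 2 = (δ * (1 + P * f)) ^ 2 := by
    linear_combination (δ * (1 + P * f)) ^ 2 * hε
  rw [hεK, hεg, hK']
  field_simp
  linear_combination (-32 * δ ^ 2 * P * c) * hR1 + (32 * δ ^ 2 * P * f * c) * hd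

/-- The quotient by `p` of the right-hand side of the congruence modulo `p^3`, where `K` stands
for `u_{p-ε}(b^2-2c,c^2) / c^(1-ε)`. -/
noncomputable def target (p : ℕ) (b c d ε : ℤ) (K : ℂ) : ℂ :=
  (b : ℂ) ^ 2 / (2 * c) * (ε - 1) +
    p / (2 * c) * (b ^ 2 * (fermatQuotient p d - fermatQuotient p c + ε) - d) -
    b ^ 2 * (2 * c + d * ε) * K / (4 * c)

/-- Take α, β = (1±δ)/2 with δ = b/√d, so αβ = -c/d. The second conclusion lets the Lucas term be
dropped when only the congruence modulo p² is wanted. -/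
theorem quotient_cong {b c d : ℤ} (hd : d = b ^ 2 - 4 * c) {p : ℕ} [hp : Fact p.Prime] (hp2 : p ≠ 2)
    (hpc : ¬ (p : ℤ) ∣ c) (hpd : ¬ (p : ℤ) ∣ d) {ε : ℤ} (hε : legendreSym p d = ε) {K : ℂ}
    (hK : (ε = 1 ∧ K = u (b ^ 2 - 2 * c) (c ^ 2) (p - 1)) ∨
      (ε = -1 ∧ K * c ^ 2 = u (b ^ 2 - 2 * c) (c ^ 2) (p + 1))) :
    Cong p 2 (2 * (-((c : ℂ) / d)) * ∑ j ∈ range p, (w p (j + 1) : ℂ) * catalan j * ((c : ℂ) / d) ^ j)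
      (2 * (-((c : ℂ) / d)) * target p b c d ε K) ∧ Cong p 1 (b ^ 2 * K) 0 := by
  obtain ⟨h, hh⟩ : ∃ h, p = 2 * h + 1 := hp.out.odd_of_ne_two hp2
  have h2 := hp.out.two_le
  have hpos := hp.out.pos
  have hp0 : (p : ℂ) ≠ 0 := Nat.cast_ne_zero.2 hp.out.ne_zero
  have ne_zero : ∀ z : ℤ, ¬ (p : ℤ) ∣ z → (z : ℂ) ≠ 0 := by
    intro z hz h; apply hz; have : z = 0 := by exact_mod_cast h
    simp [this]
  have hc0 := ne_zero c hpc
  have hd0 := ne_zero d hpd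
  have hdC : (d : ℂ) = b ^ 2 - 4 * c := by rw [hd]; push_cast; ring
  obtain ⟨s, hs⟩ : ∃ s : ℂ, s ^ 2 = d := IsAlgClosed.exists_pow_nat_eq _ two_pos
  have hs0 : s ≠ 0 := by rintro rfl; apply hd0; rw [← hs]; ring
  have hsm : s ∈ pInt p := mem_pInt_of_isIntegral
    (IsIntegral.of_pow two_pos (by rw [hs]; exact isIntegral_algebraMap))
  have hdi := inv_intCast_mem hpd
  have hci := inv_intCast_mem hpc
  have hsi : s⁻¹ ∈ pInt p := by
    have : s⁻¹ = s * (d : ℂ)⁻¹ := by rw [← hs]; field_simp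
    rw [this]; exact mul_mem hsm hdi
  have m1 := one_mem (pInt p)
  have mp := natCast_mem (pInt p) p
  have mb := intCast_mem (pInt p) b
  have mc := intCast_mem (pInt p) c
  have md := intCast_mem (pInt p) d
  have mε := intCast_mem (pInt p) ε
  have m2 : (2 : ℂ) ∈ pInt p := natCast_mem _ 2
  have m4 : (4 : ℂ) ∈ pInt p := natCast_mem _ 4
  have half : (2 : ℂ)⁻¹ ∈ pInt p := by
    have := inv_natCast_mem_of_lt (p := p) (k := 2) (by omega) (by omega)
    exact_mod_cast this
  have hKm : K ∈ pInt p := by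
    rcases hK with ⟨-, hK⟩ | ⟨-, hK⟩
    · rw [hK]; exact intCast_mem _ _
    · rw [← eq_div_iff (pow_ne_zero 2 hc0), div_eq_mul_inv, ← inv_pow] at hK
      rw [hK]; exact mul_mem (intCast_mem _ _) (pow_mem hci 2)
  have mqd := fermatQuotient_mem hpd
  have mqc := fermatQuotient_mem hpc
  have hqd := pow_prime_eq_mul (p := p) d
  have hqc := pow_prime_eq_mul (p := p) c
  obtain ⟨δ, hδ⟩ : ∃ δ : ℂ, δ = b * s⁻¹ := ⟨_, rfl⟩
  have mδ : δ ∈ pInt p := by rw [hδ]; exact mul_mem mb hsi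
  have hδ2 : (d : ℂ) * δ ^ 2 = b ^ 2 := by rw [hδ, ← hs]; field_simp
  have mα : (1 + δ) / 2 ∈ pInt p := by rw [div_eq_mul_inv]; exact mul_mem (add_mem m1 mδ) half
  have mβ : (1 - δ) / 2 ∈ pInt p := by rw [div_eq_mul_inv]; exact mul_mem (sub_mem m1 mδ) half
  have hαβ : (1 + δ) / 2 + (1 - δ) / 2 = 1 := by ring
  have hx : (1 + δ) / 2 * ((1 - δ) / 2) = -((c : ℂ) / d) := by
    have : (c : ℂ) = (b ^ 2 - d) / 4 := by linear_combination hdC / 4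
    rw [this, ← hδ2]; field_simp; ring
  have hδδ : (1 + δ) / 2 - (1 - δ) / 2 = δ := by ring
  have hQ := sum_w_catalan_cong hp2 mα mβ hαβ
  obtain ⟨e, me, hv, -⟩ := pow_add_pow_cong hp2 mα mβ hαβ
  have hD := sub_pow_prime_cong hp2 mα mβ
  have hX : (((1 + δ) / 2) ^ p * ((1 - δ) / 2) ^ p) * (d : ℂ) ^ p = -(c : ℂ) ^ p := by
    rw [← mul_pow, ← mul_pow, hx, ← (hp.out.odd_of_ne_two hp2).neg_pow]
    congr 1; field_simp
  rw [hx, hδδ, neg_neg, hv] at hQ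
  rw [hδδ] at hD
  -- If p divides b, then δ is not invertible, but δ and α^p-β^p are multiples of p. Both sides
  -- reduce to p modulo p², and only the p-integrality of K matters.
  by_cases hpb : (p : ℤ) ∣ b
  · obtain ⟨b', rfl⟩ := hpb
    push_cast at hδ hdC hδ2 ⊢
    refine ⟨hQ.trans ?_, ⟨p * b' ^ 2 * K,
      mul_mem (mul_mem mp (pow_mem (intCast_mem _ _) 2)) hKm, by ring⟩⟩
    obtain ⟨D', mD', hD'⟩ : ∃ D' ∈ pInt p, ((1 + δ) / 2) ^ p - ((1 - δ) / 2) ^ p = p * D' := by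
      obtain ⟨z, hz, hD⟩ := hD
      refine ⟨z + δ ^ (p - 1) * (b' * s⁻¹), add_mem hz (mul_mem (pow_mem mδ _)
        (mul_mem (intCast_mem _ _) hsi)), ?_⟩
      have : δ ^ p = δ ^ (p - 1) * δ := by rw [← pow_succ, Nat.sub_add_cancel hpos]
      rw [this] at hD
      linear_combination hD + δ ^ (p - 1) * hδ
    rw [hD', target]
    have mb' := intCast_mem (pInt p) b'
    refine ⟨D' ^ 2 - b' * s⁻¹ * D' * (2 + p - (1 + p * e)) + b' ^ 2 * (d : ℂ)⁻¹ * (ε - 1 +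
      p * (fermatQuotient p d - fermatQuotient p c + ε) - (2 * c + d * ε) * K * 2⁻¹), ?_, ?_⟩
    · repeat' first | assumption | apply pow_mem | apply add_mem | apply sub_mem | apply mul_mem
    · have e1 : 2 * (-((c : ℂ) / d)) * (((p * b' : ℤ) : ℂ) ^ 2 / (2 * c) * (ε - 1) +
          p / (2 * c) * (((p * b' : ℤ) : ℂ) ^ 2 * (fermatQuotient p d - fermatQuotient p c + ε) - d) -
          ((p * b' : ℤ) : ℂ) ^ 2 * (2 * c + d * ε) * K / (4 * c)) = p - p ^ 2 * (b' ^ 2 * (d : ℂ)⁻¹ * (ε - 1 +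
          p * (fermatQuotient p d - fermatQuotient p c + ε) - (2 * c + d * ε) * K * 2⁻¹)) := by
        push_cast; field_simp; ring
      rw [e1, hδ]
      ring
  · have hb0 := ne_zero b hpb
    have hδ0 : δ ≠ 0 := by rw [hδ]; exact mul_ne_zero hb0 (inv_ne_zero hs0)
    have mδi : δ⁻¹ ∈ pInt p := by
      rw [hδ, mul_inv, inv_inv]; exact mul_mem (inv_intCast_mem hpb) hsm
    have hε2 : ε ^ 2 = 1 := by rcases hK with ⟨h, -⟩ | ⟨h, -⟩ <;> rw [h] <;> norm_num
    have hε2C : (ε : ℂ) ^ 2 = 1 := by exact_mod_cast hε2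
    -- By Euler's criterion δ^(p-1) = (b²/d)^((p-1)/2) ≡ ε. With the Frobenius congruence this makes
    -- (α^p-β^p)/δ equal to ε(1+pf).
    have hleg : Cong p 1 (δ ^ (2 * h)) ε := by
      have h1 := cong_half_pow hh (b ^ 2) d hpd
      have hbz : (b : ZMod p) ≠ 0 := by rwa [Ne, ZMod.intCast_zmod_eq_zero_iff_dvd]
      rw [legendreSym.mul, legendreSym.sq_one' p hbz, one_mul, hε] at h1
      have : δ ^ 2 = ((b ^ 2 : ℤ) : ℂ) / d := by
        push_cast; rw [← hδ2]; field_simp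
      rw [pow_mul, this]; exact h1
    obtain ⟨f, mf, hf⟩ : ∃ f ∈ pInt p, ((1 + δ) / 2) ^ p - ((1 - δ) / 2) ^ p =
        δ * (ε * (1 + p * f)) := by
      have h1 := hD.mul_left mδi
      have e1 : δ⁻¹ * δ ^ p = δ ^ (2 * h) := by
        have : δ ^ p = δ * δ ^ (2 * h) := by rw [← pow_succ', ← hh]
        rw [this, ← mul_assoc, inv_mul_cancel₀ hδ0, one_mul]
      rw [e1] at h1
      obtain ⟨z, hz, h3⟩ := h1.trans hleg
      refine ⟨ε * z, mul_mem mε hz, ?_⟩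
      have h4 : ((1 + δ) / 2) ^ p - ((1 - δ) / 2) ^ p = δ * (ε + p * z) := by
        rw [pow_one] at h3
        have : ε + p * z = δ⁻¹ * (((1 + δ) / 2) ^ p - ((1 - δ) / 2) ^ p) := by linear_combination -h3
        rw [this, ← mul_assoc, mul_inv_cancel₀ hδ0, one_mul]
      rw [h4]
      linear_combination -δ * p * z * hε2C
    have ha : ((1 + δ) / 2) ^ p = ((1 + p * e) + δ * (ε * (1 + p * f))) / 2 := by
      linear_combination hv / 2 + hf / 2
    have hb : ((1 - δ) / 2) ^ p = ((1 + p * e) - δ * (ε * (1 + p * f))) / 2 := by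
      linear_combination hv / 2 - hf / 2
    rw [hf] at hQ
    have hR : (1 + p * (fermatQuotient p d : ℂ)) * (d * (1 + p * e) ^ 2 - b ^ 2 * (1 + p * f) ^ 2) +
        4 * c * (1 + p * fermatQuotient p c) = 0 := by
      rw [ha, hb, hqd, hqc] at hX
      linear_combination 4 * hX + (1 + p * (fermatQuotient p d : ℂ)) * (1 + p * f) ^ 2 * hδ2
        + (1 + p * (fermatQuotient p d : ℂ)) * d * (1 + p * f) ^ 2 * δ ^ 2 * hε2C
    -- Multiplying K by ε merges the indices p-1 and p+1 into one formula. The factor p(e-f) comes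
    -- from g-v when ε = 1 and from v+g when ε = -1.
    obtain ⟨K₀, hK₀, hK₀'⟩ : ∃ K₀ : ℂ, K = ε * K₀ ∧ 4 * (c : ℂ) ^ 2 * K₀ = p * (e - f) * (4 * c -
        p * (-4 * c * fermatQuotient p d + (1 + p * fermatQuotient p d) * d * (e - δ ^ 2 * f))) := by
      have h4 : (d : ℂ) * (1 - δ ^ 2) + 4 * c = 0 := by linear_combination hdC - hδ2
      refine ⟨ε * K, by linear_combination -K * hε2C, ?_⟩
      rcases hK with ⟨rfl, hK⟩ | ⟨rfl, hK⟩
      · have h1 := u_pred_eq hpos hdC hδ2 hd0 hδ0 ha hb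
        rw [← hK, hqd] at h1
        push_cast at h1 ⊢
        linear_combination h1 + p * (f - e) * (1 + p * fermatQuotient p d) * h4
      · have h1 := u_succ_eq hdC hδ2 hd0 hδ0 ha hb
        rw [← hK, hqd] at h1
        push_cast at h1 ⊢
        linear_combination -h1 + p * (f - e) * (1 + p * fermatQuotient p d) * h4
    set Y : ℂ := -4 * c * fermatQuotient p d + (1 + p * fermatQuotient p d) * d * (e - δ ^ 2 * f)
    have hqi : (8 : ℂ)⁻¹ ∈ pInt p := by
      have : (8 : ℂ)⁻¹ = 2⁻¹ * 2⁻¹ * 2⁻¹ := by norm_num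
      rw [this]; exact mul_mem (mul_mem half half) half
    have hqi4 : (4 : ℂ)⁻¹ ∈ pInt p := by
      have : (4 : ℂ)⁻¹ = 2⁻¹ * 2⁻¹ := by norm_num
      rw [this]; exact mul_mem half half
    have mm4 : (-4 : ℂ) ∈ pInt p := neg_mem m4
    have ht := target_identity hp0 hc0 hd0 hε2C hdC hδ2 hK₀' hR
    rw [← hK₀] at ht
    refine ⟨hQ.trans ⟨_, ?_, ht⟩, ?_⟩
    · repeat' first | assumption | apply pow_mem | apply add_mem | apply sub_mem | apply mul_mem
    · refine ⟨b ^ 2 * (ε * ((e - f) * (4 * c - p * Y) * (4⁻¹ * (c : ℂ)⁻¹ ^ 2))), ?_, ?_⟩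
      · apply_rules [add_mem, mul_mem, sub_mem, pow_mem]
      · have : K₀ = p * (e - f) * (4 * c - p * Y) * (4⁻¹ * (c : ℂ)⁻¹ ^ 2) := by
          rw [← hK₀']; field_simp
        rw [hK₀, this]; ring

theorem sum_T_mul_M_cong {b c d : ℤ} (hd : d = b ^ 2 - 4 * c) {p : ℕ} [hp : Fact p.Prime] (hp2 : p ≠ 2)
    (hpc : ¬ (p : ℤ) ∣ c) (hpd : ¬ (p : ℤ) ∣ d) {ε : ℤ} (hε : legendreSym p d = ε) {K : ℂ}
    (hK : (ε = 1 ∧ K = u (b ^ 2 - 2 * c) (c ^ 2) (p - 1)) ∨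
      (ε = -1 ∧ K * c ^ 2 = u (b ^ 2 - 2 * c) (c ^ 2) (p + 1))) :
    Cong p 3 (∑ k ∈ range p, (T k b c : ℂ) * M k b c / (d : ℂ) ^ k) (p * target p b c d ε K) ∧
    Cong p 2 (∑ k ∈ range p, (T k b c : ℂ) * M k b c / (d : ℂ) ^ k)
      (p * b ^ 2 / (2 * c) * (ε - 1)) := by
  obtain ⟨h1, h2⟩ := quotient_cong hd hp2 hpc hpd hε hK
  have hd0 : d ≠ 0 := by rintro rfl; simp at hpd
  have hc0 : c ≠ 0 := by rintro rfl; simp at hpc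
  have hdC : (d : ℂ) ≠ 0 := by exact_mod_cast hd0
  have hcC : (c : ℂ) ≠ 0 := by exact_mod_cast hc0
  have hhalf : ((2 : ℕ) : ℂ)⁻¹ ∈ pInt p := inv_natCast_mem_of_lt (by omega)
    (by have := hp.out.two_le; omega)
  have half : (2 : ℂ)⁻¹ ∈ pInt p := by exact_mod_cast hhalf
  have hci := inv_intCast_mem hpc
  have md := intCast_mem (pInt p) d
  have m2 : (2 : ℂ) ∈ pInt p := natCast_mem _ 2
  have hsum : ∑ k ∈ range p, (T k b c : ℂ) * M k b c / (d : ℂ) ^ k =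
      p * ∑ j ∈ range p, (w p (j + 1) : ℂ) * catalan j * ((c : ℂ) / d) ^ j := by
    have := congrArg (Rat.cast : ℚ → ℂ) (sum_T_mul_M_div b c d hd hd0 p)
    push_cast at this
    rw [this, mul_sum]
    refine sum_congr rfl fun j _ => ?_
    rw [← mul_w]; push_cast; ring
  have h4 : Cong p 3 (∑ k ∈ range p, (T k b c : ℂ) * M k b c / (d : ℂ) ^ k) (p * target p b c d ε K) := by
    rw [hsum]
    -- The factor -2c/d is a p-unit and can be cancelled; the outer factor p raises the modulus to
    -- p³.
    refine (Cong.cancel_left (w := -((2 : ℂ)⁻¹ * ((c : ℂ)⁻¹ * d))) ?_ h1 ?_).p_mul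
    · exact neg_mem (mul_mem half (mul_mem hci md))
    · field_simp
  refine ⟨h4, (h4.of_le (by norm_num)).trans ?_⟩
  obtain ⟨z, hz, hzK⟩ := h2
  refine ⟨2⁻¹ * (c : ℂ)⁻¹ * (b ^ 2 * (fermatQuotient p d - fermatQuotient p c + ε) - d) -
    (2 * c + d * ε) * z * (2⁻¹ * 2⁻¹ * (c : ℂ)⁻¹), ?_, ?_⟩
  · have mb := intCast_mem (pInt p) b
    have mc := intCast_mem (pInt p) c
    have mε := intCast_mem (pInt p) ε
    have mqd := fermatQuotient_mem hpd
    have mqc := fermatQuotient_mem hpc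
    repeat' first | assumption | apply pow_mem | apply add_mem | apply sub_mem | apply mul_mem
  · rw [sub_zero, pow_one] at hzK
    have e : target p b c d ε K = (b : ℂ) ^ 2 / (2 * c) * (ε - 1) +
        p / (2 * c) * (b ^ 2 * (fermatQuotient p d - fermatQuotient p c + ε) - d) -
        (2 * c + d * ε) * (p * z) / (4 * c) := by
      rw [target, ← hzK]; ring
    rw [e]; field_simp; ring

end TrinomialMotzkin

/-! ### The main theorem -/

theorem theorem3p1 (b c d : ℤ) (hd : d = b ^ 2 - 4 * c) :
    (∀ n : ℕ, 0 < n →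
      (1 / (n : ℚ)) * ∑ k ∈ Finset.range n,
          (TrinomialMotzkin.T k b c : ℚ) * (TrinomialMotzkin.M k b c : ℚ) * (d : ℚ) ^ (n - 1 - k)
        = ∑ k ∈ Finset.Icc 1 n,
          TrinomialMotzkin.w n k * (catalan (k - 1) : ℚ) * (c : ℚ) ^ (k - 1) * (d : ℚ) ^ (n - k) ∧
      ∃ z : ℤ, ∑ k ∈ Finset.Icc 1 n,
          TrinomialMotzkin.w n k * (catalan (k - 1) : ℚ) * (c : ℚ) ^ (k - 1) * (d : ℚ) ^ (n - k)
        = (z : ℚ)) ∧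
    (∀ (p : ℕ) [Fact p.Prime], p ≠ 2 → ¬ (p : ℤ) ∣ c * d →
      TrinomialMotzkin.RatModEq (p ^ 2)
        (∑ k ∈ Finset.range p,
          (TrinomialMotzkin.T k b c : ℚ) * (TrinomialMotzkin.M k b c : ℚ) / (d : ℚ) ^ k)
        ((p : ℚ) * (b : ℚ) ^ 2 / (2 * (c : ℚ)) * ((legendreSym p d : ℚ) - 1)) ∧
      TrinomialMotzkin.RatModEq (p ^ 3)
        (∑ k ∈ Finset.range p,
          (TrinomialMotzkin.T k b c : ℚ) * (TrinomialMotzkin.M k b c : ℚ) / (d : ℚ) ^ k)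
        ((p : ℚ) * (b : ℚ) ^ 2 / (2 * (c : ℚ)) * ((legendreSym p d : ℚ) - 1)
          + (p : ℚ) ^ 2 / (2 * (c : ℚ))
            * ((b : ℚ) ^ 2 * (TrinomialMotzkin.fermatQuotient p d
                - TrinomialMotzkin.fermatQuotient p c + (legendreSym p d : ℚ)) - (d : ℚ))
          - (p : ℚ) * (b : ℚ) ^ 2 / (4 * (c : ℚ) ^ ((2 : ℤ) - legendreSym p d))
            * (2 * (c : ℚ) + (d : ℚ) * (legendreSym p d : ℚ))
            * (TrinomialMotzkin.u (b ^ 2 - 2 * c) (c ^ 2)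
                ((p : ℤ) - legendreSym p d).toNat : ℚ))) ∧
    (∀ (p : ℕ) [Fact p.Prime], p ≠ 2 → ¬ (p : ℤ) ∣ d →
      TrinomialMotzkin.RatModEq p
        (∑ k ∈ Finset.range p,
          (k : ℚ) * (TrinomialMotzkin.T k b c : ℚ) * (TrinomialMotzkin.M k b c : ℚ) / (d : ℚ) ^ k)
        (2 * (legendreSym p (c * d) : ℚ))) := by
  refine ⟨fun n hn => ⟨TrinomialMotzkin.mean_T_mul_M b c d hd n hn,
    TrinomialMotzkin.sum_w_mem_int c d n⟩, ?_,
    fun p _ hp2 hpd => TrinomialMotzkin.sum_k_mul_T_mul_M b c d hd p hp2 hpd⟩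
  intro p hp hp2 hpcd
  have hpc : ¬ (p : ℤ) ∣ c := fun h => hpcd (h.mul_right d)
  have hpd : ¬ (p : ℤ) ∣ d := fun h => hpcd (h.mul_left c)
  have hcC : (c : ℂ) ≠ 0 := by
    intro h
    have : c = 0 := by exact_mod_cast h
    simp [this] at hpc
  have hpos := hp.out.pos
  have hdz : (d : ZMod p) ≠ 0 := by rwa [Ne, ZMod.intCast_zmod_eq_zero_iff_dvd]
  rcases legendreSym.eq_one_or_neg_one p hdz with hε | hε
  · have h := TrinomialMotzkin.sum_T_mul_M_cong hd hp2 hpc hpd hε (Or.inl ⟨rfl, rfl⟩)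
    have e : ((p : ℤ) - 1).toNat = p - 1 := by omega
    rw [hε, e, show (2 : ℤ) - 1 = 1 by norm_num, zpow_one]
    constructor
    · apply TrinomialMotzkin.Cong.ratModEq
      have := h.2
      push_cast at this ⊢
      exact this
    · apply TrinomialMotzkin.Cong.ratModEq
      have := h.1
      push_cast at this ⊢
      refine this.trans (TrinomialMotzkin.Cong.of_eq ?_)
      rw [TrinomialMotzkin.target]
      push_cast; field_simp
  -- For ε = -1 the exponent 2-ε is 3: one factor c belongs to the prefactor, the other two to K =
  -- u_{p+1}/c².
  · have h := TrinomialMotzkin.sum_T_mul_M_cong hd hp2 hpc hpd hε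
      (K := TrinomialMotzkin.u (b ^ 2 - 2 * c) (c ^ 2) (p + 1) / (c : ℂ) ^ 2)
      (Or.inr ⟨rfl, by field_simp⟩)
    have e : ((p : ℤ) - -1).toNat = p + 1 := by omega
    rw [hε, e, show (2 : ℤ) - -1 = (3 : ℕ) by norm_num, zpow_natCast]
    constructor
    · apply TrinomialMotzkin.Cong.ratModEq
      have := h.2
      push_cast at this ⊢
      exact this
    · apply TrinomialMotzkin.Cong.ratModEq
      have := h.1
      push_cast at this ⊢
      refine this.trans (TrinomialMotzkin.Cong.of_eq ?_)
      rw [TrinomialMotzkin.target]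
      push_cast; field_simp
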